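/- Let $a,b,d\in C^0[0,1]$ with $\frac ba\in L^1(0,1)$, $a(0)=d(0)=0$, $a,d>0$ on $(0,1]$, and let $K_1,K_2\in(0,2)$ be such that $x\mapsto x^{K_1}/a(x)$ and $x\mapsto x^{K_2}/d(x)$ are nondecreasing in a right neighbourhood of $0$. Put $$\eta(x)=\exp\Big(\int_{1/2}^x\frac{b(s)}{a(s)}\,ds\Big),\qquad \sigma=\frac a\eta,\qquad x\in[0,1].$$ Let $L^2_{1/\sigma}(0,1)=\{u\in L^2(0,1):\int_0^1 u^2/\sigma\,dx<\infty\}$ with $\langle u,v\rangle_{1/\sigma}=\int_0^1 \frac{uv}{\sigma}dx$; let $H^1_{1/\sigma,0}(0,1)=\{u\in L^2_{1/\sigma}(0,1)\cap H^1(0,1): u(0)=0\}$ with $\langle u,v\rangle_{1,1/\sigma}=\langle u,v\rangle_{1/\sigma}+\int_0^1\eta u'v'dx$; let $Au=au''+bu'=\sigma(\eta u')'$ and $H^2_{1/\sigma,0}(0,1)=D(A)=\{u\in H^1_{1/\sigma,0}(0,1):Au\in L^2_{1/\sigma}(0,1)\}$, with inner product $\langle u,v\rangle_{1,1/\sigma}+\langle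 Au,Av\rangle_{1/\sigma}$; for $\lambda\in\mathbb R$ let $A_\lambda u=Au+\lambda\frac ud$ on $D(A_\lambda)=\{u\in H^2_{1/\sigma,0}(0,1):A_\lambda u\in L^2_{1/\sigma}(0,1)\}$, with the graph norm. Let $C_{HP}$ be the best constant $C$ in $$\int_0^1\frac{u^2}{\sigma d}\,dx\le C\int_0^1\eta (u')^2dx\qquad\text{for all }u\in H^1_{1/\sigma,0}(0,1).$$ Assume $K_1+2K_2\le2$, $\lambda\in\mathbb R\setminus\{0\}$, $\lambda<1/C_{HP}$ and $\beta\ge0$, and consider the problem $$\begin{cases} y_{tt}-a y_{xx}-b y_x-\frac{\lambda}{d}y=0,&(t,x)\in(0,\infty)\times(0,1),\\ y_t(t,1)+\eta(1) y_x(t,1)+\beta y(t,1)=0,& t>0,\\ y(t,0)=0,& t>0,\\ y(0,x)=y_0(x),\quad y_t(0,x)=y_1(x),& x\in(0,1).\end{cases}\tag{P}$$ With $\mathcal H_0=H^1_{1/\sigma,0}(0,1)\times L^2_{1/\sigma}(0,1)$, let $\mathcal A(u,v)=(v,A_\lambda u)$ on $$D(\mathcal A)=\{(u,v)\in D(A_\lambda)\times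 H^1_{1/\sigma,0}(0,1):\ \eta(1)u'(1)+v(1)+\beta u(1)=0\}.$$ A mild solution of (P) is the first component $y$ of some $Y=(y,z)\in C([0,\infty);\mathcal H_0)$ such that, for all $t\ge0$, $\int_0^tY(s)\,ds\in D(\mathcal A)$ and $Y(t)=(y_0,y_1)+\mathcal A\int_0^tY(s)\,ds$. Then: 1. For every $(y_0,y_1)\in H^1_{1/\sigma,0}(0,1)\times L^2_{1/\sigma}(0,1)$ there is a unique mild solution $y$ of (P); it lies in $C^1([0,\infty);L^2_{1/\sigma}(0,1))\cap C([0,\infty);H^1_{1/\sigma,0}(0,1))$ and satisfies $y(0)=y_0$, $y_t(0)=y_1$. 2. The mild solution depends continuously on the initial data: there is $C>0$ such that, for any mild solutions $y,\tilde y$ with data $(y_0,y_1)$, $(\tilde y_0,\tilde y_1)$ and all $t\ge0$, $$\|y(t)-\tilde y(t)\|_{1,1/\sigma}+\|y_t(t)-\tilde y_t(t)\|_{1/\sigma}\le C\big(\|y_0-\tilde y_0\|_{1,1/\sigma}+\|y_1-\tilde y_1\|_{1/\sigma}\big).$$ 3. If $(y_0,y_1)\in H^2_{1/\sigma,0}(0,1)\times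 H^1_{1/\sigma,0}(0,1)$ satisfies the compatibility condition $\eta(1)y_0'(1)+y_1(1)+\beta y_0(1)=0$, then the mild solution $y$ is classical: $$y\in C^2([0,\infty);L^2_{1/\sigma}(0,1))\cap C^1([0,\infty);H^1_{1/\sigma,0}(0,1))\cap C([0,\infty);D(A_\lambda)),$$ and $y_{tt}(t)=A_\lambda y(t)$ in $L^2_{1/\sigma}(0,1)$ and $y_t(t,1)+\eta(1)y_x(t,1)+\beta y(t,1)=0$ hold for all $t\ge0$. -/

import Mathlib

open MeasureTheory Set Filter Topology
open scoped ContDiff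

noncomputable section

namespace DegWave

/-! ### Coefficients and weights -/

/-- The structural assumptions on the coefficients `a` (degenerate leading coefficient), `b` (drift)
and `d` (singular potential `1 / d`), with exponents `K₁`, `K₂`. -/
structure CoeffHyp (a b d : ℝ → ℝ) (K₁ K₂ : ℝ) : Prop where
  cont_a : ContinuousOn a (Icc 0 1)
  cont_b : ContinuousOn b (Icc 0 1)
  cont_d : ContinuousOn d (Icc 0 1)
  integrable_drift : IntegrableOn (fun x => b x / a x) (Ioo 0 1)
  a_zero : a 0 = 0
  d_zero : d 0 = 0
  a_pos : ∀ x ∈ Ioc (0 : ℝ) 1, 0 < a x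
  d_pos : ∀ x ∈ Ioc (0 : ℝ) 1, 0 < d x
  K₁_mem : K₁ ∈ Ioo (0 : ℝ) 2
  K₂_mem : K₂ ∈ Ioo (0 : ℝ) 2
  mono_a : ∃ δ ∈ Ioc (0 : ℝ) 1, MonotoneOn (fun x => x ^ K₁ / a x) (Ioo 0 δ)
  mono_d : ∃ δ ∈ Ioc (0 : ℝ) 1, MonotoneOn (fun x => x ^ K₂ / d x) (Ioo 0 δ)

/-- Feller's weight `η(x) = exp (∫_{1/2}^x b/a)`. -/
def eta (a b : ℝ → ℝ) (x : ℝ) : ℝ := Real.exp (∫ s in (1 / 2 : ℝ)..x, b s / a s)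

/-- `σ = a / η`. -/
def sig (a b : ℝ → ℝ) (x : ℝ) : ℝ := a x / eta a b x

/-- The measure `dx / σ` on `(0,1)`. -/
def muSig (a b : ℝ → ℝ) : Measure ℝ :=
  (volume.restrict (Ioo (0 : ℝ) 1)).withDensity (fun x => ENNReal.ofReal (1 / sig a b x))

/-- The measure `η dx` on `(0,1)`. -/
def muEta (a b : ℝ → ℝ) : Measure ℝ :=
  (volume.restrict (Ioo (0 : ℝ) 1)).withDensity (fun x => ENNReal.ofReal (eta a b x))

/-! ### Weak derivatives and boundary values on `(0,1)` -/

/-- `g` is the weak derivative of `f` on `(0,1)`. -/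
def IsWeakDeriv (f g : ℝ → ℝ) : Prop :=
  LocallyIntegrableOn f (Ioo (0 : ℝ) 1) ∧ LocallyIntegrableOn g (Ioo (0 : ℝ) 1) ∧
    ∀ φ : ℝ → ℝ, ContDiff ℝ ∞ φ → HasCompactSupport φ → tsupport φ ⊆ Ioo (0 : ℝ) 1 →
      ∫ x in Ioo (0 : ℝ) 1, f x * deriv φ x = - ∫ x in Ioo (0 : ℝ) 1, g x * φ x

/-- The function class `f` on `(0,1)` has a representative that is continuous on `(0,1) ∪ {x}`
and takes the value `c` at the point `x`. -/
def HasValueAt (f : ℝ → ℝ) (x c : ℝ) : Prop :=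
  ∃ v : ℝ → ℝ, ContinuousOn v (insert x (Ioo (0 : ℝ) 1)) ∧
    f =ᵐ[volume.restrict (Ioo (0 : ℝ) 1)] v ∧ v x = c

lemma integrable_mul_of_compactSupport {f ψ : ℝ → ℝ}
    (hf : LocallyIntegrableOn f (Ioo (0 : ℝ) 1)) (hψ : Continuous ψ) (hc : HasCompactSupport ψ)
    (hs : tsupport ψ ⊆ Ioo (0 : ℝ) 1) :
    Integrable (fun x => f x * ψ x) (volume.restrict (Ioo (0 : ℝ) 1)) := by
  have h1 : IntegrableOn f (tsupport ψ) := hf.integrableOn_compact_subset hs hc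
  have h2 : IntegrableOn (fun x => f x * ψ x) (tsupport ψ) :=
    h1.mul_continuousOn hψ.continuousOn hc
  have h3 : Integrable (fun x => f x * ψ x) volume := by
    refine (integrableOn_iff_integrable_of_support_subset ?_).1 h2
    intro x hx
    by_contra h
    exact hx (by simp [image_eq_zero_of_notMem_tsupport h])
  exact h3.restrict

lemma tsupport_deriv_sub (φ : ℝ → ℝ) : tsupport (deriv φ) ⊆ tsupport φ :=
  closure_minimal support_deriv_subset (isClosed_tsupport φ)

lemma IsWeakDeriv.add {f g f' g' : ℝ → ℝ} (h : IsWeakDeriv f g) (h' : IsWeakDeriv f' g') :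
    IsWeakDeriv (fun x => f x + f' x) (fun x => g x + g' x) := by
  refine ⟨h.1.add h'.1, h.2.1.add h'.2.1, fun φ hφ hc hs => ?_⟩
  have hd : Continuous (deriv φ) := hφ.continuous_deriv (by simp)
  have hds := (tsupport_deriv_sub φ).trans hs
  simp only [add_mul]
  rw [integral_add (integrable_mul_of_compactSupport h.1 hd hc.deriv hds)
      (integrable_mul_of_compactSupport h'.1 hd hc.deriv hds),
    integral_add (integrable_mul_of_compactSupport h.2.1 hφ.continuous hc hs)
      (integrable_mul_of_compactSupport h'.2.1 hφ.continuous hc hs),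
    h.2.2 φ hφ hc hs, h'.2.2 φ hφ hc hs]
  ring

lemma IsWeakDeriv.smul {f g : ℝ → ℝ} (c : ℝ) (h : IsWeakDeriv f g) :
    IsWeakDeriv (fun x => c * f x) (fun x => c * g x) := by
  refine ⟨h.1.smul c, h.2.1.smul c, fun φ hφ hc hs => ?_⟩
  simp only [mul_assoc, integral_const_mul]
  rw [h.2.2 φ hφ hc hs]
  ring

lemma IsWeakDeriv.zero : IsWeakDeriv (fun _ => 0) (fun _ => 0) :=
  ⟨locallyIntegrable_zero.locallyIntegrableOn _, locallyIntegrable_zero.locallyIntegrableOn _,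
    fun φ _ _ _ => by simp⟩

/-! ### Function spaces -/

/-- `L²_{1/σ}(0,1)`, with inner product `∫ u v / σ`.  As `σ` is bounded above and positive on
`(0,1)`, every element is automatically in `L²(0,1)`. -/
abbrev L2w (a b : ℝ → ℝ) : Type := Lp ℝ 2 (muSig a b)

/-- `H¹_{1/σ,0}(0,1)`: the functions `u ∈ L²_{1/σ}(0,1)` with weak derivative `u' ∈ L²(0,1)` and
`u(0) = 0`.  The function `u` is stored as the pair `(u, u')`, so that the inherited inner product is
`∫ u v / σ + ∫ η u' v'`.  (As `η` is bounded above and below by positive constants,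
`L²(η dx)` is `L²(0,1)`; functions with such a derivative have a representative that is
continuous on `[0,1]`.) -/
def H10 (a b : ℝ → ℝ) : Submodule ℝ (WithLp 2 (L2w a b × Lp ℝ 2 (muEta a b))) where
  carrier := {p | ∃ f g : ℝ → ℝ, p.fst =ᵐ[muSig a b] f ∧ p.snd =ᵐ[muEta a b] g ∧
    IsWeakDeriv f g ∧ ContinuousOn f (Icc 0 1) ∧ f 0 = 0}
  add_mem' := by
    rintro p q ⟨f, g, hf, hg, hw, hc, h0⟩ ⟨f', g', hf', hg', hw', hc', h0'⟩
    refine ⟨fun x => f x + f' x, fun x => g x + g' x, ?_, ?_, hw.add hw', hc.add hc', by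
      simp [h0, h0']⟩
    · exact (Lp.coeFn_add p.fst q.fst).trans (hf.add hf')
    · exact (Lp.coeFn_add p.snd q.snd).trans (hg.add hg')
  zero_mem' :=
    ⟨fun _ => 0, fun _ => 0, Lp.coeFn_zero _ _ _, Lp.coeFn_zero _ _ _, IsWeakDeriv.zero,
      continuousOn_const, rfl⟩
  smul_mem' := by
    rintro c p ⟨f, g, hf, hg, hw, hc, h0⟩
    refine ⟨fun x => c * f x, fun x => c * g x, ?_, ?_, hw.smul c, continuousOn_const.mul hc, by
      simp [h0]⟩
    · exact (Lp.coeFn_smul c p.fst).trans (hf.const_smul c)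
    · exact (Lp.coeFn_smul c p.snd).trans (hg.const_smul c)

/-- The inclusion `H¹_{1/σ,0} ⊆ L²_{1/σ}`. -/
def toL2 {a b : ℝ → ℝ} (u : H10 a b) : L2w a b := u.1.fst

/-- The weak derivative `u'`. -/
def der {a b : ℝ → ℝ} (u : H10 a b) : Lp ℝ 2 (muEta a b) := u.1.snd

/-- `H²_{1/σ,0}(0,1) = D(A)`: the functions `u ∈ H¹_{1/σ,0}` with `A u = σ (η u')' ∈ L²_{1/σ}`.
The function `u` is stored as the pair `(u, A u)`, so that the inherited inner product is
`⟨u,v⟩_{1,1/σ} + ⟨A u, A v⟩_{1/σ}`. -/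
def H2 (a b : ℝ → ℝ) : Submodule ℝ (WithLp 2 (H10 a b × L2w a b)) where
  carrier := {p | ∃ g G : ℝ → ℝ, der p.fst =ᵐ[muEta a b] g ∧
    IsWeakDeriv (fun x => eta a b x * g x) G ∧
    p.snd =ᵐ[muSig a b] fun x => sig a b x * G x}
  add_mem' := by
    rintro p q ⟨g, G, hg, hw, hG⟩ ⟨g', G', hg', hw', hG'⟩
    refine ⟨fun x => g x + g' x, fun x => G x + G' x, ?_, ?_, ?_⟩
    · exact (Lp.coeFn_add (der p.fst) (der q.fst)).trans (hg.add hg')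
    · simpa only [mul_add] using hw.add hw'
    · simp only [mul_add]
      exact (Lp.coeFn_add p.snd q.snd).trans (hG.add hG')
  zero_mem' :=
    ⟨fun _ => 0, fun _ => 0, Lp.coeFn_zero _ _ _, by simpa using IsWeakDeriv.zero, by
      simp only [mul_zero]
      exact Lp.coeFn_zero ℝ 2 (muSig a b)⟩
  smul_mem' := by
    rintro c p ⟨g, G, hg, hw, hG⟩
    refine ⟨fun x => c * g x, fun x => c * G x, ?_, ?_, ?_⟩
    · exact (Lp.coeFn_smul c (der p.fst)).trans (hg.const_smul c)
    · simpa only [mul_left_comm] using hw.smul c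
    · simp only [mul_left_comm _ c]
      exact (Lp.coeFn_smul c p.snd).trans (hG.const_smul c)

/-- The inclusion `H²_{1/σ,0} ⊆ H¹_{1/σ,0}`. -/
def toH10 {a b : ℝ → ℝ} (u : H2 a b) : H10 a b := u.1.fst

/-- The operator `A u = a u'' + b u' = σ (η u')'`. -/
def opA {a b : ℝ → ℝ} (u : H2 a b) : L2w a b := u.1.snd

/-- `D(A_λ)`: the functions `u ∈ H²_{1/σ,0}` with `A_λ u = A u + λ u / d ∈ L²_{1/σ}`.
The function `u` is stored as the pair `(u, A_λ u)`, which gives the graph norm. -/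
def DAlam (a b d : ℝ → ℝ) (lam : ℝ) : Submodule ℝ (WithLp 2 (H2 a b × L2w a b)) where
  carrier := {p | p.snd =ᵐ[muSig a b]
    fun x => opA p.fst x + lam * (toL2 (toH10 p.fst) x / d x)}
  add_mem' := by
    intro p q hp hq
    have h1 := Lp.coeFn_add p.snd q.snd
    have h2 := Lp.coeFn_add (opA p.fst) (opA q.fst)
    have h3 := Lp.coeFn_add (toL2 (toH10 p.fst)) (toL2 (toH10 q.fst))
    simp only [mem_ofPred_eq] at hp hq ⊢
    filter_upwards [h1, h2, h3, hp, hq] with x h1 h2 h3 hp hq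
    change (p.snd + q.snd : L2w a b) x = (opA p.fst + opA q.fst : L2w a b) x
      + lam * ((toL2 (toH10 p.fst) + toL2 (toH10 q.fst) : L2w a b) x / d x)
    rw [h1, h2, h3, Pi.add_apply, Pi.add_apply, Pi.add_apply, hp, hq]
    ring
  zero_mem' := by
    have h := Lp.coeFn_zero ℝ 2 (muSig a b)
    simp only [mem_ofPred_eq]
    filter_upwards [h] with x h
    change (0 : L2w a b) x = (0 : L2w a b) x + lam * ((0 : L2w a b) x / d x)
    rw [h]
    simp
  smul_mem' := by
    intro c p hp
    have h1 := Lp.coeFn_smul c p.snd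
    have h2 := Lp.coeFn_smul c (opA p.fst)
    have h3 := Lp.coeFn_smul c (toL2 (toH10 p.fst))
    simp only [mem_ofPred_eq] at hp ⊢
    filter_upwards [h1, h2, h3, hp] with x h1 h2 h3 hp
    change (c • p.snd : L2w a b) x = (c • opA p.fst : L2w a b) x
      + lam * ((c • toL2 (toH10 p.fst) : L2w a b) x / d x)
    rw [h1, h2, h3, Pi.smul_apply, Pi.smul_apply, Pi.smul_apply, hp]
    simp only [smul_eq_mul]
    ring

/-- The inclusion `D(A_λ) ⊆ H¹_{1/σ,0}`. -/
def domToH10 {a b d : ℝ → ℝ} {lam : ℝ} (u : DAlam a b d lam) : H10 a b := toH10 u.1.fst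

/-- The operator `A_λ`. -/
def opAlam {a b d : ℝ → ℝ} {lam : ℝ} (u : DAlam a b d lam) : L2w a b := u.1.snd

/-! ### The Hardy-Poincaré constant -/

/-- The best constant `C` in `∫ u² / (σ d) ≤ C ∫ η (u')²`, `u ∈ H¹_{1/σ,0}(0,1)`. -/
def CHP (a b d : ℝ → ℝ) : ℝ :=
  sInf {C : ℝ | 0 < C ∧ ∀ u : H10 a b,
    IntegrableOn (fun x => toL2 u x ^ 2 / (sig a b x * d x)) (Ioo 0 1) ∧
    ∫ x in Ioo (0 : ℝ) 1, toL2 u x ^ 2 / (sig a b x * d x)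
      ≤ C * ∫ x in Ioo (0 : ℝ) 1, eta a b x * der u x ^ 2}

/-! ### The Cauchy problem -/

/-- The boundary condition `v(1) + η(1) u'(1) + β u(1) = 0` (with `v = u_t`). -/
def BoundaryCond {a b : ℝ → ℝ} (beta : ℝ) (u v : H10 a b) : Prop :=
  ∃ p q r : ℝ, HasValueAt (toL2 v) 1 p ∧ HasValueAt (der u) 1 q ∧ HasValueAt (toL2 u) 1 r ∧
    p + eta a b 1 * q + beta * r = 0

/-- `𝓗₀ = H¹_{1/σ,0} × L²_{1/σ}`. -/
abbrev H0 (a b : ℝ → ℝ) : Type := WithLp 2 (H10 a b × L2w a b)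

/-- `Gen a b d lam beta U F` means: `U = (u, v)` lies in
`D(𝓐) = {(u, v) ∈ D(A_λ) × H¹_{1/σ,0} : η(1) u'(1) + v(1) + β u(1) = 0}`
and `F = 𝓐 U = (v, A_λ u)`. -/
def Gen (a b d : ℝ → ℝ) (lam beta : ℝ) (U F : H0 a b) : Prop :=
  (∃ w : DAlam a b d lam, domToH10 w = U.fst ∧ opAlam w = F.snd) ∧
    toL2 F.fst = U.snd ∧ BoundaryCond beta U.fst F.fst

/-- `Y` is a mild solution of `Y' = 𝓐 Y`, `Y(0) = Y₀`: it is continuous on `[0,∞)` and, for all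
`t ≥ 0`, `∫₀ᵗ Y ∈ D(𝓐)` and `Y(t) = Y₀ + 𝓐 ∫₀ᵗ Y`. -/
def IsMildCauchy (a b d : ℝ → ℝ) (lam beta : ℝ) (Y₀ : H0 a b) (Y : ℝ → H0 a b) : Prop :=
  ContinuousOn Y (Ici 0) ∧
    ∀ t : ℝ, 0 ≤ t → Gen a b d lam beta (∫ s in (0 : ℝ)..t, Y s) (Y t - Y₀)

/-- `y` is a mild solution of the damped degenerate/singular wave equation with
data `(y₀, y₁)`: it is the first component of a mild solution `(y, z)` of the Cauchy problem. -/
def IsMildSolution (a b d : ℝ → ℝ) (lam beta : ℝ) (y₀ : H10 a b) (y₁ : L2w a b)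
    (y : ℝ → H10 a b) : Prop :=
  ∃ z : ℝ → L2w a b,
    IsMildCauchy a b d lam beta (WithLp.toLp 2 (y₀, y₁)) (fun t => WithLp.toLp 2 (y t, z t))

/-- The curve `y` seen in `L²_{1/σ}`. -/
def curveL2 {a b : ℝ → ℝ} (y : ℝ → H10 a b) : ℝ → L2w a b := fun t => toL2 (y t)

/-- `y_t(t)`, in `L²_{1/σ}` (one-sided at `t = 0`). -/
def velL2 {a b : ℝ → ℝ} (y : ℝ → H10 a b) (t : ℝ) : L2w a b := derivWithin (curveL2 y) (Ici 0) t

/-- `y` is a classical solution: it lies in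
`C²([0,∞); L²_{1/σ}) ∩ C¹([0,∞); H¹_{1/σ,0}) ∩ C([0,∞); D(A_λ))`, and
`y_tt = A_λ y` and the boundary condition at `1` hold for all `t ≥ 0`
(the condition `y(t,0) = 0` is contained in `H¹_{1/σ,0}`). -/
def IsClassicalSolution (a b d : ℝ → ℝ) (lam beta : ℝ) (y : ℝ → H10 a b) : Prop :=
  ContDiffOn ℝ 2 (curveL2 y) (Ici 0) ∧ ContDiffOn ℝ 1 y (Ici 0) ∧
    (∃ w : ℝ → DAlam a b d lam, ContinuousOn w (Ici 0) ∧ ∀ t : ℝ, 0 ≤ t →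
      domToH10 (w t) = y t ∧
        iteratedDerivWithin 2 (curveL2 y) (Ici 0) t = opAlam (w t)) ∧
    ∀ t : ℝ, 0 ≤ t → BoundaryCond beta (y t) (derivWithin y (Ici 0) t)

end DegWave

end

/-!
Write `u ∈ H¹_{1/σ,0}` as `u(x) = ∫₀ˣ g` with `g = u' ∈ L²(η dx)`; this identifies the space with
`L²(η dx)`, and `u(1) = ∫₀¹ g` becomes a bounded functional.  Since `1/a = O(x^{-K₁})` and
`1/d = O(x^{-K₂})`, the assumption `K₁ + 2 K₂ ≤ 2` gives `1/(σ d²) = O(x⁻²)`, so that Hardy's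
inequality bounds `u ↦ u / d` from `H¹_{1/σ,0}` into `L²_{1/σ}` (`CoeffHyp.potOp`).  In particular
`D(A_λ) = D(A)`.

By Fubini's theorem on the triangle `s < x` the adjoint of `g ↦ ∫₀ˣ g` is
`k ↦ (1/η) ∫ₛ¹ k/σ`.  Hence
`σ (η g)' = k` together with `η(1) g(1) = p` is equivalent to the identity
`η g + ∫ₛ¹ k/σ = p` almost everywhere, and thereby to the weak form
`⟨g, h⟩ + ⟨k, ∫₀ˣ h⟩_{1/σ} = p ∫₀¹ h` for all `h ∈ L²(η dx)` (`CoeffHyp.weakForm_iff`); no boundary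
term survives at the degenerate endpoint.  So the generator `𝓐 (u, v) = (v, A_λ u)` has a purely
variational description (`CoeffHyp.gen_iff`).

With the energy form `E = ∫ η u'² + ∫ v²/σ - λ ∫ u²/(σ d) + β u(1)²` the weak form gives
`E(𝓐 U, U) = - v(1)² ≤ 0`.  The condition `λ < 1 / C_HP` makes `E` coercive, and the Lax–Milgram
theorem solves `U - h 𝓐 U = F` for all `h > 0`.  Thus `𝓐` is maximal dissipative for `E`
(`CoeffHyp.isMaxDissipative`).

For such operators the Cauchy problem is solved by the Yosida approximations
`𝓐 (1 - h 𝓐)⁻¹`: Kōmura's estimate (`IsMaxDissipative.form_expFlow_sub_le`) shows that their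
exponentials converge on the domain, which is dense, and the energy bound extends the convergence to
all data (`IsMaxDissipative.exists_mild`).  The energy also yields uniqueness and the uniform
continuous dependence on the data.  For data in the domain the solution is `Y₀ + ∫ Z` with `Z`
the mild solution started at `𝓐 Y₀`, which is the additional regularity of classical solutions.
-/

noncomputable section

namespace DegWave

/-! ### Abstract Cauchy problems for generators that dissipate a quadratic form -/

section Abstract

variable {X : Type*} [NormedAddCommGroup X] [InnerProductSpace ℝ X]

/-- The linear relation `G ⊆ X × X` is the graph of an operator which is maximal dissipative with
respect to the symmetric coercive form `B`.  The form `B`, rather than the inner product of `X`,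
plays the role of the energy, so that `X` need not be renormed. -/
structure IsMaxDissipative (B : X →L[ℝ] X →L[ℝ] ℝ) (G : Submodule ℝ (X × X)) : Prop where
  symm : ∀ x y, B x y = B y x
  coercive : IsCoercive B
  dissipative : ∀ p ∈ G, B p.2 p.1 ≤ 0
  range : ∀ h : ℝ, 0 < h → ∀ x, ∃ p ∈ G, p.1 - h • p.2 = x
  single : ∀ y, ((0 : X), y) ∈ G → y = 0

/-- `Y` is a mild solution of `Y' = 𝓐 Y`, `Y(0) = x`, where `G` is the graph of `𝓐`. -/
def IsMild (G : Submodule ℝ (X × X)) (x : X) (Y : ℝ → X) : Prop :=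
  ContinuousOn Y (Ici 0) ∧ ∀ t : ℝ, 0 ≤ t → ((∫ s in (0 : ℝ)..t, Y s), Y t - x) ∈ G

/-- The energy inequality along a differentiable curve. -/
lemma form_le_of_deriv_le {B : X →L[ℝ] X →L[ℝ] ℝ} (hs : ∀ x y, B x y = B y x) {Y Y' : ℝ → X}
    {ε : ℝ} (hc : ContinuousOn Y (Ici 0)) (hd : ∀ t, 0 < t → HasDerivAt Y (Y' t) t)
    (hB : ∀ t, 0 < t → B (Y' t) (Y t) ≤ ε) {t : ℝ} (ht : 0 ≤ t) :
    B (Y t) (Y t) ≤ B (Y 0) (Y 0) + 2 * ε * t := by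
  have hder : ∀ s, 0 < s →
      HasDerivAt (fun s => B (Y s) (Y s) - 2 * ε * s) (2 * B (Y' s) (Y s) - 2 * ε) s := by
    intro s hs0
    have h1 : HasDerivAt (fun s => B (Y s)) (B (Y' s)) s :=
      B.hasFDerivAt.comp_hasDerivAt s (hd s hs0)
    have h2 := h1.clm_apply (hd s hs0)
    have h3 := h2.sub ((hasDerivAt_id s).const_mul (2 * ε))
    have he : B (Y' s) (Y s) + B (Y s) (Y' s) - 2 * ε * 1 = 2 * B (Y' s) (Y s) - 2 * ε := by
      rw [hs (Y s) (Y' s)]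
      ring
    rw [← he]
    exact h3
  have hanti : AntitoneOn (fun s => B (Y s) (Y s) - 2 * ε * s) (Ici 0) := by
    apply antitoneOn_of_deriv_nonpos (convex_Ici 0)
    · exact ((B.continuous.comp_continuousOn hc).clm_apply hc).sub (by fun_prop)
    · rw [interior_Ici]
      exact fun s hs0 => (hder s hs0).differentiableAt.differentiableWithinAt
    · rw [interior_Ici]
      intro s hs0
      rw [(hder s hs0).deriv]
      linarith [hB s hs0]
  have := hanti (mem_Ici.2 le_rfl) (mem_Ici.2 ht) ht
  simp only [mul_zero, sub_zero] at this
  linarith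

lemma hasDerivWithinAt_integral_Ici {E : Type*} [NormedAddCommGroup E] [NormedSpace ℝ E]
    [CompleteSpace E] {Y : ℝ → E} (hY : ContinuousOn Y (Ici 0)) {t : ℝ} (ht : 0 ≤ t) :
    HasDerivWithinAt (fun t => ∫ s in (0 : ℝ)..t, Y s) (Y t) (Ici 0) t := by
  have hint : IntervalIntegrable Y volume 0 (t + 1) := by
    apply ContinuousOn.intervalIntegrable
    rw [uIcc_of_le (by linarith)]
    exact hY.mono Icc_subset_Ici_self
  have hmem : t ∈ Icc (0 : ℝ) (t + 1) := ⟨ht, by linarith⟩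
  have h : HasDerivWithinAt (fun t => ∫ s in (0 : ℝ)..t, Y s) (Y t) (Icc 0 (t + 1)) t := by
    have : Fact (t ∈ Icc (0 : ℝ) (t + 1)) := ⟨hmem⟩
    refine intervalIntegral.integral_hasDerivWithinAt_right
      (hint.mono_set (by rw [uIcc_of_le ht, uIcc_of_le (by linarith)]
                         exact Icc_subset_Icc_right (by linarith)))
      (t := Icc 0 (t + 1)) ?_ ?_
    · exact (hY.mono Icc_subset_Ici_self).stronglyMeasurableAtFilter_nhdsWithin
        measurableSet_Icc t
    · exact (hY.mono Icc_subset_Ici_self) t hmem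
  refine h.mono_of_mem_nhdsWithin ?_
  rw [← Ici_inter_Iic]
  exact inter_mem self_mem_nhdsWithin (mem_nhdsWithin_of_mem_nhds (Iic_mem_nhds (by linarith)))

lemma intervalIntegrable_of_continuousOn_Ici {E : Type*} [NormedAddCommGroup E]
    {Y : ℝ → E} (hY : ContinuousOn Y (Ici 0)) {t : ℝ} (ht : 0 ≤ t) :
    IntervalIntegrable Y volume 0 t := by
  apply ContinuousOn.intervalIntegrable
  rw [uIcc_of_le ht]
  exact hY.mono Icc_subset_Ici_self

variable {B : X →L[ℝ] X →L[ℝ] ℝ} {G : Submodule ℝ (X × X)}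

lemma IsMild.sub [CompleteSpace X] {x y : X} {Y Z : ℝ → X} (hY : IsMild G x Y)
    (hZ : IsMild G y Z) :
    IsMild G (x - y) (fun t => Y t - Z t) := by
  refine ⟨hY.1.sub hZ.1, fun t ht => ?_⟩
  rw [intervalIntegral.integral_sub (intervalIntegrable_of_continuousOn_Ici hY.1 ht)
    (intervalIntegrable_of_continuousOn_Ici hZ.1 ht), sub_sub_sub_comm]
  exact G.sub_mem (hY.2 t ht) (hZ.2 t ht)

namespace IsMaxDissipative

lemma nonneg (hG : IsMaxDissipative B G) (x : X) : 0 ≤ B x x := by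
  obtain ⟨c, hc, h⟩ := hG.coercive
  exact le_trans (by positivity) (h x)

/-- The energy controls the norm. -/
lemma exists_norm_le (hG : IsMaxDissipative B G) :
    ∃ L : ℝ, 0 < L ∧ ∀ x y : X, B x x ≤ B y y → ‖x‖ ≤ L * ‖y‖ := by
  obtain ⟨c, hc, h⟩ := hG.coercive
  refine ⟨Real.sqrt (‖B‖ / c) + 1, by positivity, fun x y hxy => ?_⟩
  have h1 : c * ‖x‖ ^ 2 ≤ ‖B‖ * ‖y‖ ^ 2 := by
    have h2 := h x
    have h3 : B y y ≤ ‖B‖ * ‖y‖ * ‖y‖ := (le_abs_self _).trans (B.le_opNorm₂ y y)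
    nlinarith
  have h4 : ‖x‖ ≤ Real.sqrt (‖B‖ / c) * ‖y‖ := by
    refine abs_le_of_sq_le_sq' ?_ (by positivity) |>.2
    rw [mul_pow, Real.sq_sqrt (by positivity), div_mul_eq_mul_div, le_div_iff₀ hc]
    linarith
  nlinarith [norm_nonneg y]

lemma form_fst_le (hG : IsMaxDissipative B G) {p : X × X} (hp : p ∈ G) {h : ℝ} (hh : 0 < h) :
    B p.1 p.1 ≤ B (p.1 - h • p.2) (p.1 - h • p.2) := by
  have h1 := hG.dissipative p hp
  have h2 := hG.nonneg p.2
  simp only [map_sub, map_smul, sub_apply, smul_apply,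
    smul_eq_mul]
  rw [hG.symm p.1 p.2]
  nlinarith [mul_nonneg hh.le (mul_nonneg hh.le h2), mul_nonneg hh.le (neg_nonneg.2 h1)]

lemma eq_of_sub_smul_eq (hG : IsMaxDissipative B G) {p q : X × X} (hp : p ∈ G) (hq : q ∈ G)
    {h : ℝ} (hh : 0 < h) (hpq : p.1 - h • p.2 = q.1 - h • q.2) : p = q := by
  obtain ⟨L, -, hLn⟩ := hG.exists_norm_le
  have h1 := hG.form_fst_le (G.sub_mem hp hq) hh
  have h2 : (p - q).1 - h • (p - q).2 = 0 := by
    have : (p - q).1 - h • (p - q).2 = (p.1 - h • p.2) - (q.1 - h • q.2) := by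
      simp only [Prod.fst_sub, Prod.snd_sub, smul_sub]; abel
    rw [this, hpq, sub_self]
  rw [h2] at h1
  have h3 := hLn _ _ h1
  rw [norm_zero, mul_zero] at h3
  have h4 : (p - q).1 = 0 := norm_le_zero_iff.1 h3
  rw [h4, zero_sub, neg_eq_zero, smul_eq_zero] at h2
  have h5 : p - q = 0 := Prod.ext h4 (h2.resolve_left hh.ne')
  exact sub_eq_zero.1 h5

/-- The resolvent `(1 - h 𝓐)⁻¹`. -/
lemma exists_resolvent (hG : IsMaxDissipative B G) {h : ℝ} (hh : 0 < h) :
    ∃ J : X →L[ℝ] X, (∀ x, (J x, h⁻¹ • (J x - x)) ∈ G) ∧ ∀ p ∈ G, J (p.1 - h • p.2) = p.1 := by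
  obtain ⟨L, hL, hLn⟩ := hG.exists_norm_le
  choose p hpG hp using hG.range h hh
  have huniq : ∀ x (q : X × X), q ∈ G → q.1 - h • q.2 = x → p x = q := fun x q hq hqx =>
    hG.eq_of_sub_smul_eq (hpG x) hq hh ((hp x).trans hqx.symm)
  let J₀ : X →ₗ[ℝ] X :=
    { toFun := fun x => (p x).1
      map_add' := fun x y => by
        rw [huniq (x + y) (p x + p y) (G.add_mem (hpG x) (hpG y))
          (by rw [Prod.fst_add, Prod.snd_add, smul_add, add_sub_add_comm, hp, hp])]
        rfl
      map_smul' := fun r x => by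
        rw [huniq (r • x) (r • p x) (G.smul_mem r (hpG x))
          (by rw [Prod.smul_fst, Prod.smul_snd, smul_comm, ← smul_sub, hp])]
        rfl }
  refine ⟨J₀.mkContinuous L fun x => hLn _ _ ?_, fun x => ?_, fun q hq => ?_⟩
  · have h1 := hG.form_fst_le (hpG x) hh
    rwa [hp] at h1
  · convert hpG x using 1
    refine Prod.ext rfl ?_
    change h⁻¹ • ((p x).1 - x) = (p x).2
    nth_rw 2 [← hp x]
    rw [sub_sub_cancel, inv_smul_smul₀ hh.ne']
  · change (p (q.1 - h • q.2)).1 = q.1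
    rw [huniq _ q hq rfl]

lemma isClosed (hG : IsMaxDissipative B G) : IsClosed (G : Set (X × X)) := by
  obtain ⟨J, hJ, hJ'⟩ := hG.exists_resolvent one_pos
  have : (G : Set (X × X)) = {p | J (p.1 - (1 : ℝ) • p.2) = p.1} := by
    ext p
    refine ⟨fun hp => hJ' p hp, fun hp => ?_⟩
    have h1 := hJ (p.1 - (1 : ℝ) • p.2)
    rw [show J (p.1 - (1 : ℝ) • p.2) = p.1 from hp] at h1
    simpa using h1
  rw [this]
  exact isClosed_eq (by fun_prop) (by fun_prop)

lemma integral_mem [CompleteSpace X] (hG : IsMaxDissipative B G)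
    {Y Z : ℝ → X} (hY : ContinuousOn Y (Ici 0))
    (hZ : ContinuousOn Z (Ici 0)) (hYZ : ∀ t, 0 ≤ t → (Y t, Z t) ∈ G) {t : ℝ} (ht : 0 ≤ t) :
    ((∫ s in (0 : ℝ)..t, Y s), ∫ s in (0 : ℝ)..t, Z s) ∈ G := by
  obtain ⟨J, hJ, hJ'⟩ := hG.exists_resolvent one_pos
  have hYi := intervalIntegrable_of_continuousOn_Ici hY ht
  have hZi := intervalIntegrable_of_continuousOn_Ici hZ ht
  have h1 : J ((∫ s in (0 : ℝ)..t, Y s) - ∫ s in (0 : ℝ)..t, Z s) = ∫ s in (0 : ℝ)..t, Y s := by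
    rw [← intervalIntegral.integral_sub hYi hZi,
      ← ContinuousLinearMap.intervalIntegral_comp_comm J (hYi.sub hZi)]
    refine intervalIntegral.integral_congr fun s hs => ?_
    rw [uIcc_of_le ht] at hs
    simpa using hJ' _ (hYZ s hs.1)
  have h2 := hJ ((∫ s in (0 : ℝ)..t, Y s) - ∫ s in (0 : ℝ)..t, Z s)
  rw [h1] at h2
  simpa using h2

/-- The domain of a maximal dissipative operator in a Hilbert space is dense: if `x` is
`B`-orthogonal to it and `x = u - 𝓐 u`, then `B(u, u) = B(𝓐 u, u) ≤ 0`. -/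
lemma dense_domain [CompleteSpace X] (hG : IsMaxDissipative B G) :
    Dense ((G.map (LinearMap.fst ℝ X X) : Submodule ℝ X) : Set X) := by
  rw [Submodule.dense_iff_topologicalClosure_eq_top, Submodule.topologicalClosure_eq_top_iff,
    Submodule.eq_bot_iff]
  intro y hy
  set e := hG.coercive.continuousLinearEquivOfBilin
  obtain ⟨x, rfl⟩ := e.surjective y
  obtain ⟨p, hp, hpx⟩ := hG.range 1 one_pos x
  have h1 : B x p.1 = 0 := by
    rw [← hG.coercive.continuousLinearEquivOfBilin_apply]
    exact (Submodule.mem_orthogonal' _ _).1 hy p.1 ⟨p, hp, rfl⟩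
  obtain ⟨c, hc, hcx⟩ := hG.coercive
  have h2 : p.1 = 0 := by
    have h3 := hcx p.1
    have h4 := hG.dissipative p hp
    rw [← hpx, one_smul, map_sub, sub_apply] at h1
    have h5 : c * ‖p.1‖ * ‖p.1‖ ≤ 0 := by linarith
    by_contra hne
    have := norm_pos_iff.2 hne
    have : 0 < c * ‖p.1‖ * ‖p.1‖ := by positivity
    linarith
  have h6 : p.2 = 0 := hG.single _ (by rw [← h2]; exact hp)
  rw [← hpx, h2, h6]
  simp

/-- The energy of a mild solution started at `0` vanishes: `W = ∫ Y` satisfies `W' = 𝓐 W`. -/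
lemma mild_eq_zero [CompleteSpace X] (hG : IsMaxDissipative B G)
    {Y : ℝ → X} (hY : IsMild G 0 Y) {t : ℝ}
    (ht : 0 ≤ t) : Y t = 0 := by
  obtain ⟨L, -, hLn⟩ := hG.exists_norm_le
  have hW : ∀ t, 0 ≤ t → (∫ s in (0 : ℝ)..t, Y s) = 0 := by
    intro t ht
    have h1 := form_le_of_deriv_le (B := B) (ε := 0) hG.symm
      (Y := fun t => ∫ s in (0 : ℝ)..t, Y s) (Y' := Y)
      (fun t ht => (hasDerivWithinAt_integral_Ici hY.1 ht).continuousWithinAt)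
      (fun t ht => (hasDerivWithinAt_integral_Ici hY.1 ht.le).hasDerivAt (Ici_mem_nhds ht))
      (fun t ht => by simpa using hG.dissipative _ (hY.2 t ht.le)) ht
    simp only [intervalIntegral.integral_same, mul_zero, zero_mul, add_zero] at h1
    have h2 := hLn _ 0 h1
    rw [norm_zero, mul_zero] at h2
    exact norm_le_zero_iff.1 h2
  have h1 := hY.2 t ht
  rw [hW t ht, sub_zero] at h1
  exact hG.single _ h1

lemma mild_unique [CompleteSpace X] (hG : IsMaxDissipative B G)
    {x : X} {Y Z : ℝ → X} (hY : IsMild G x Y)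
    (hZ : IsMild G x Z) : EqOn Y Z (Ici 0) := by
  intro t ht
  have h := hY.sub hZ
  rw [sub_self] at h
  exact sub_eq_zero.1 (hG.mild_eq_zero h ht)

end IsMaxDissipative

/-! ### Existence of mild solutions by Yosida approximation -/

/-- The solution of `Y' = A Y`, `Y(0) = x` for a bounded operator `A`. -/
def expFlow (A : X →L[ℝ] X) (x : X) (t : ℝ) : X := NormedSpace.exp (t • A) x

lemma expFlow_zero (A : X →L[ℝ] X) (x : X) : expFlow A x 0 = x := by
  simp [expFlow]

lemma expFlow_sub (A : X →L[ℝ] X) (x y : X) (t : ℝ) :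
    expFlow A (x - y) t = expFlow A x t - expFlow A y t := by
  simp [expFlow]

lemma hasDerivAt_expFlow [CompleteSpace X] (A : X →L[ℝ] X) (x : X) (t : ℝ) :
    HasDerivAt (expFlow A x) (A (expFlow A x t)) t := by
  have h := (hasDerivAt_exp_smul_const' (𝕂 := ℝ) A t).clm_apply (hasDerivAt_const t x)
  have he : (A * NormedSpace.exp (t • A)) x + NormedSpace.exp (t • A) 0 = A (expFlow A x t) := by
    simp [expFlow]
  rw [← he]
  exact h

lemma apply_expFlow [CompleteSpace X] (A : X →L[ℝ] X) (x : X) (t : ℝ) :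
    A (expFlow A x t) = expFlow A (A x) t := by
  have h1 := (hasDerivAt_exp_smul_const' (𝕂 := ℝ) A t).unique (hasDerivAt_exp_smul_const A t)
  exact congrArg (fun T : X →L[ℝ] X => T x) h1

lemma continuous_expFlow [CompleteSpace X] (A : X →L[ℝ] X) (x : X) : Continuous (expFlow A x) :=
  continuous_iff_continuousAt.2 fun t => (hasDerivAt_expFlow A x t).continuousAt

lemma integral_apply_expFlow [CompleteSpace X] (A : X →L[ℝ] X) (x : X) (t : ℝ) :
    A (∫ s in (0 : ℝ)..t, expFlow A x s) = expFlow A x t - x := by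
  rw [← ContinuousLinearMap.intervalIntegral_comp_comm A
    ((continuous_expFlow A x).intervalIntegrable _ _)]
  rw [intervalIntegral.integral_eq_sub_of_hasDerivAt (fun s _ => hasDerivAt_expFlow A x s)
    ((A.continuous.comp (continuous_expFlow A x)).intervalIntegrable _ _), expFlow_zero]

/-- `A` is the Yosida approximation `𝓐 (1 - h 𝓐)⁻¹ = h⁻¹ ((1 - h 𝓐)⁻¹ - 1)` of the operator `𝓐`
with graph `G`; note that `(1 - h 𝓐)⁻¹ = 1 + h A`. -/
def IsYosida (G : Submodule ℝ (X × X)) (h : ℝ) (A : X →L[ℝ] X) : Prop :=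
  (∀ x, (x + h • A x, A x) ∈ G) ∧ ∀ p ∈ G, A p.1 = p.2 + h • A p.2

namespace IsMaxDissipative

lemma exists_yosida (hG : IsMaxDissipative B G) {h : ℝ} (hh : 0 < h) :
    ∃ A : X →L[ℝ] X, IsYosida G h A := by
  obtain ⟨J, hJ, hJ'⟩ := hG.exists_resolvent hh
  refine ⟨h⁻¹ • (J - ContinuousLinearMap.id ℝ X), fun x => ?_, fun p hp => ?_⟩
  · have h1 : x + h • (h⁻¹ • (J - ContinuousLinearMap.id ℝ X)) x = J x := by
      simp [smul_inv_smul₀ hh.ne']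
    rw [h1]
    exact hJ x
  · have h1 := hJ' p hp
    simp only [map_sub, map_smul] at h1
    simp only [smul_apply, sub_apply, ContinuousLinearMap.id_apply, smul_inv_smul₀ hh.ne',
      add_sub_cancel]
    rw [inv_smul_eq_iff₀ hh.ne', sub_eq_iff_eq_add, add_comm, ← sub_eq_iff_eq_add]
    exact h1

lemma yosida_dissipative (hG : IsMaxDissipative B G) {h : ℝ} (hh : 0 < h) {A : X →L[ℝ] X}
    (hA : IsYosida G h A) (x : X) : B (A x) x ≤ 0 := by
  have h1 := hG.dissipative _ (hA.1 x)
  simp only [map_add, map_smul, smul_eq_mul] at h1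
  nlinarith [mul_nonneg hh.le (hG.nonneg (A x))]

lemma yosida_form_le (hG : IsMaxDissipative B G) {h : ℝ} (hh : 0 < h) {A : X →L[ℝ] X}
    (hA : IsYosida G h A) {p : X × X} (hp : p ∈ G) : B (A p.1) (A p.1) ≤ B p.2 p.2 := by
  rw [hA.2 p hp]
  simpa using hG.form_fst_le (hA.1 p.2) hh

lemma form_expFlow_le [CompleteSpace X] (hG : IsMaxDissipative B G) {h : ℝ} (hh : 0 < h)
    {A : X →L[ℝ] X} (hA : IsYosida G h A) (x : X) {t : ℝ} (ht : 0 ≤ t) :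
    B (expFlow A x t) (expFlow A x t) ≤ B x x := by
  have := form_le_of_deriv_le hG.symm (ε := 0) (continuous_expFlow A x).continuousOn
    (fun t _ => hasDerivAt_expFlow A x t) (fun t _ => hG.yosida_dissipative hh hA _) ht
  simpa [expFlow_zero] using this

/-- Kōmura's estimate: on the domain of `𝓐`, the flows of two Yosida approximations with parameters
`h`, `k` differ at time `t` by `O(√((h + k) t))`. -/
lemma form_expFlow_sub_le [CompleteSpace X] (hG : IsMaxDissipative B G) {h k : ℝ} (hh : 0 < h)
    (hk : 0 < k) {A A' : X →L[ℝ] X} (hA : IsYosida G h A) (hA' : IsYosida G k A') {p : X × X}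
    (hp : p ∈ G) {t : ℝ} (ht : 0 ≤ t) :
    B (expFlow A p.1 t - expFlow A' p.1 t) (expFlow A p.1 t - expFlow A' p.1 t) ≤
      2 * ((h + k) * B p.2 p.2) * t := by
  have key := form_le_of_deriv_le hG.symm (ε := (h + k) * B p.2 p.2)
    (Y := fun t => expFlow A p.1 t - expFlow A' p.1 t)
    (Y' := fun t => A (expFlow A p.1 t) - A' (expFlow A' p.1 t))
    ((continuous_expFlow A _).sub (continuous_expFlow A' _)).continuousOn
    (fun t _ => (hasDerivAt_expFlow A _ t).sub (hasDerivAt_expFlow A' _ t)) ?_ ht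
  · simpa [expFlow_zero] using key
  intro s hs
  have ha : B (A (expFlow A p.1 s)) (A (expFlow A p.1 s)) ≤ B p.2 p.2 := by
    rw [apply_expFlow]
    exact (hG.form_expFlow_le hh hA _ hs.le).trans (hG.yosida_form_le hh hA hp)
  have ha' : B (A' (expFlow A' p.1 s)) (A' (expFlow A' p.1 s)) ≤ B p.2 p.2 := by
    rw [apply_expFlow]
    exact (hG.form_expFlow_le hk hA' _ hs.le).trans (hG.yosida_form_le hk hA' hp)
  set u := expFlow A p.1 s
  set v := expFlow A' p.1 s
  have h1 := hG.dissipative _ (G.sub_mem (hA.1 u) (hA'.1 v))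
  have h2 := hG.nonneg (A u - A' v)
  have h3 := hG.nonneg (A u)
  have h4 := hG.nonneg (A' v)
  simp only [Prod.fst_sub, Prod.snd_sub, map_add, map_sub, map_smul, sub_apply, smul_eq_mul]
    at h1 h2 ⊢
  rw [hG.symm (A' v) (A u)] at h1 h2
  -- `u - v = (J u - J' v) - (h A u - k A' v)`, and the first bracket is handled by dissipativity
  have h5 : B (A u) (A' v) ≤ B p.2 p.2 := by linarith
  nlinarith [mul_le_mul_of_nonneg_left h5 (add_pos hh hk).le, mul_nonneg hh.le h3,
    mul_nonneg hk.le h4]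

/-- Along `h = 1 / (n + 1)` the Yosida flows converge locally uniformly, and their limit is the
mild solution. -/
theorem exists_mild [CompleteSpace X] (hG : IsMaxDissipative B G) (x : X) :
    ∃ Y : ℝ → X, IsMild G x Y ∧ ∀ t, 0 ≤ t → B (Y t) (Y t) ≤ B x x := by
  obtain ⟨L, hL, hLn⟩ := hG.exists_norm_le
  obtain ⟨c, hc, hcoer⟩ := hG.coercive
  set h : ℕ → ℝ := fun n => 1 / ((n : ℝ) + 1) with hdef
  have hh : ∀ n, 0 < h n := fun n => by positivity
  have hlim : Tendsto h atTop (𝓝 0) := tendsto_one_div_add_atTop_nhds_zero_nat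
  choose A hA using fun n => hG.exists_yosida (hh n)
  have hcauchy : ∀ T : ℝ, UniformCauchySeqOn (fun n => expFlow (A n) x) atTop (Icc 0 T) := by
    intro T
    rw [Metric.uniformCauchySeqOn_iff]
    intro ε hε
    obtain ⟨x', hx', ⟨p, hp, rfl⟩⟩ := Metric.dense_iff.1 hG.dense_domain x (ε / (4 * L))
      (by positivity)
    change p.1 ∈ _ at hx'
    have hx'' : ‖x - p.1‖ < ε / (4 * L) := by
      rw [← dist_eq_norm, dist_comm]
      exact hx'
    have hM := hG.nonneg p.2
    have hlim2 : Tendsto (fun n => 4 * (B p.2 p.2 * |T|) * h n) atTop (𝓝 0) := by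
      simpa using hlim.const_mul (4 * (B p.2 p.2 * |T|))
    obtain ⟨N, hN⟩ := eventually_atTop.1
      (hlim2.eventually (gt_mem_nhds (show 0 < c * (ε / 2) ^ 2 by positivity)))
    refine ⟨N, fun m hm n hn t ht => ?_⟩
    have hclose : ∀ n, ‖expFlow (A n) x t - expFlow (A n) p.1 t‖ < ε / 4 := by
      intro n
      rw [← expFlow_sub]
      calc _ ≤ L * ‖x - p.1‖ := hLn _ _ (hG.form_expFlow_le (hh n) (hA n) _ ht.1)
        _ < L * (ε / (4 * L)) := by gcongr
        _ = ε / 4 := by field_simp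
    have hmid : ‖expFlow (A m) p.1 t - expFlow (A n) p.1 t‖ < ε / 2 := by
      apply lt_of_pow_lt_pow_left₀ 2 (by positivity)
      have h1 := hG.form_expFlow_sub_le (hh m) (hh n) (hA m) (hA n) hp ht.1
      have h2 := hcoer (expFlow (A m) p.1 t - expFlow (A n) p.1 t)
      have h3 := hN m hm
      have h4 := hN n hn
      have h5 : 2 * ((h m + h n) * B p.2 p.2) * t ≤ 2 * ((h m + h n) * B p.2 p.2) * |T| := by
        have := add_pos (hh m) (hh n)
        have := ht.2.trans (le_abs_self T)
        gcongr
      have h6 : c * ‖expFlow (A m) p.1 t - expFlow (A n) p.1 t‖ ^ 2 < c * (ε / 2) ^ 2 := by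
        nlinarith
      exact lt_of_mul_lt_mul_left h6 hc.le
    rw [dist_eq_norm]
    calc ‖expFlow (A m) x t - expFlow (A n) x t‖
        = ‖(expFlow (A m) x t - expFlow (A m) p.1 t) + (expFlow (A m) p.1 t - expFlow (A n) p.1 t)
          - (expFlow (A n) x t - expFlow (A n) p.1 t)‖ := by congr 1; abel
      _ ≤ ‖expFlow (A m) x t - expFlow (A m) p.1 t‖ + ‖expFlow (A m) p.1 t - expFlow (A n) p.1 t‖
          + ‖expFlow (A n) x t - expFlow (A n) p.1 t‖ :=
        (norm_sub_le _ _).trans (by gcongr; exact norm_add_le _ _)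
      _ < ε := by linarith [hclose m, hclose n]
  have hpt : ∀ t, ∃ y, 0 ≤ t → Tendsto (fun n => expFlow (A n) x t) atTop (𝓝 y) := by
    intro t
    by_cases ht : 0 ≤ t
    · obtain ⟨y, hy⟩ := cauchySeq_tendsto_of_complete
        ((hcauchy t).cauchySeq (x := t) ⟨ht, le_rfl⟩)
      exact ⟨y, fun _ => hy⟩
    · exact ⟨0, fun h => absurd h ht⟩
  choose Y hY using hpt
  have hunif : ∀ T, TendstoUniformlyOn (fun n => expFlow (A n) x) Y atTop (Icc 0 T) := fun T =>
    (hcauchy T).tendstoUniformlyOn_of_tendsto fun t ht => hY t ht.1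
  have hYc : ContinuousOn Y (Ici 0) := by
    intro t ht
    have h1 : ContinuousOn Y (Icc 0 (t + 1)) := (hunif (t + 1)).continuousOn
      (Eventually.of_forall fun n => (continuous_expFlow (A n) x).continuousOn).frequently
    refine (h1 t ⟨ht, by linarith⟩).mono_of_mem_nhdsWithin ?_
    rw [← Ici_inter_Iic]
    exact inter_mem self_mem_nhdsWithin (mem_nhdsWithin_of_mem_nhds (Iic_mem_nhds (by linarith)))
  refine ⟨Y, ⟨hYc, fun t ht => ?_⟩, fun t ht => ?_⟩
  · have hint : Tendsto (fun n => ∫ s in (0 : ℝ)..t, expFlow (A n) x s) atTop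
        (𝓝 (∫ s in (0 : ℝ)..t, Y s)) := by
      rw [tendsto_iff_norm_sub_tendsto_zero]
      rw [Metric.tendsto_atTop]
      intro ε hε
      obtain ⟨N, hN⟩ := eventually_atTop.1
        (Metric.tendstoUniformlyOn_iff.1 (hunif t) (ε / (t + 1)) (by positivity))
      refine ⟨N, fun n hn => ?_⟩
      rw [dist_zero_right, norm_norm, ← intervalIntegral.integral_sub
        ((continuous_expFlow (A n) x).intervalIntegrable _ _)
        (intervalIntegrable_of_continuousOn_Ici hYc ht)]
      have h1 := intervalIntegral.norm_integral_le_of_norm_le_const (a := 0) (b := t)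
        (C := ε / (t + 1)) (f := fun s => expFlow (A n) x s - Y s) (fun s hs => by
          rw [uIoc_of_le ht] at hs
          have := hN n hn s ⟨hs.1.le, hs.2⟩
          rw [dist_comm, dist_eq_norm] at this
          exact this.le)
      rw [sub_zero, abs_of_nonneg ht] at h1
      refine h1.trans_lt ?_
      rw [div_mul_eq_mul_div, div_lt_iff₀ (by positivity)]
      nlinarith
    have h2 : Tendsto (fun n => expFlow (A n) x t - x) atTop (𝓝 (Y t - x)) :=
      (hY t ht).sub_const x
    have h3 : Tendsto (fun n => ((∫ s in (0 : ℝ)..t, expFlow (A n) x s) +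
        h n • (expFlow (A n) x t - x), expFlow (A n) x t - x)) atTop
        (𝓝 ((∫ s in (0 : ℝ)..t, Y s), Y t - x)) := by
      refine Tendsto.prodMk_nhds ?_ h2
      simpa using hint.add (hlim.smul h2)
    refine hG.isClosed.mem_of_tendsto h3 (Eventually.of_forall fun n => ?_)
    have h4 := (hA n).1 (∫ s in (0 : ℝ)..t, expFlow (A n) x s)
    rwa [integral_apply_expFlow] at h4
  · have h1 : Tendsto (fun n => B (expFlow (A n) x t) (expFlow (A n) x t)) atTop
        (𝓝 (B (Y t) (Y t))) :=
      (((by fun_prop : Continuous fun y => B y y).tendsto (Y t))).comp (hY t ht)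
    exact le_of_tendsto' h1 fun n => hG.form_expFlow_le (hh n) (hA n) x ht

lemma mild_form_le [CompleteSpace X] (hG : IsMaxDissipative B G) {x : X} {Y : ℝ → X}
    (hY : IsMild G x Y) {t : ℝ} (ht : 0 ≤ t) : B (Y t) (Y t) ≤ B x x := by
  obtain ⟨Z, hZ, hZB⟩ := hG.exists_mild x
  rw [hG.mild_unique hY hZ ht]
  exact hZB t ht

lemma mild_zero [CompleteSpace X] (hG : IsMaxDissipative B G) {x : X} {Y : ℝ → X}
    (hY : IsMild G x Y) : Y 0 = x := by
  have h := hY.2 0 le_rfl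
  rw [intervalIntegral.integral_same] at h
  exact sub_eq_zero.1 (hG.single _ h)

/-- A mild solution with datum in the domain is `x + ∫ Z`, where `Z` is the mild solution with
datum `𝓐 x`. -/
lemma mild_of_mem_domain [CompleteSpace X] (hG : IsMaxDissipative B G) {p : X × X} (hp : p ∈ G)
    {Y : ℝ → X} (hY : IsMild G p.1 Y) :
    ∃ Z : ℝ → X, ContinuousOn Z (Ici 0) ∧
      ∀ t, 0 ≤ t → (Y t, Z t) ∈ G ∧ HasDerivWithinAt Y (Z t) (Ici 0) t := by
  obtain ⟨Z, hZ, -⟩ := hG.exists_mild p.2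
  set W : ℝ → X := fun t => p.1 + ∫ s in (0 : ℝ)..t, Z s
  have hWd : ∀ t, 0 ≤ t → HasDerivWithinAt W (Z t) (Ici 0) t := fun t ht =>
    (hasDerivWithinAt_integral_Ici hZ.1 ht).const_add p.1
  have hWG : ∀ t, 0 ≤ t → (W t, Z t) ∈ G := by
    intro t ht
    have h1 : p + ((∫ s in (0 : ℝ)..t, Z s), Z t - p.2) = (W t, Z t) := by
      ext <;> simp [W]
    rw [← h1]
    exact G.add_mem hp (hZ.2 t ht)
  have hWm : IsMild G p.1 W := by
    refine ⟨fun t ht => (hWd t ht).continuousWithinAt, fun t ht => ?_⟩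
    have h1 := hG.integral_mem (fun t ht => (hWd t ht).continuousWithinAt) hZ.1 hWG ht
    simpa [W] using h1
  have heq := hG.mild_unique hY hWm
  refine ⟨Z, hZ.1, fun t ht => ⟨?_, ?_⟩⟩
  · rw [heq ht]
    exact hWG t ht
  · exact (hWd t ht).congr heq (heq ht)

end IsMaxDissipative

end Abstract

/-! ### Integration on the unit interval: Fubini on the triangle, Hardy's inequality -/

lemma restrict_Ioo_restrict_Iio {x : ℝ} (hx : x ∈ Ioo (0 : ℝ) 1) :
    (volume.restrict (Ioo (0 : ℝ) 1)).restrict (Iio x) = volume.restrict (Ioo 0 x) := by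
  rw [Measure.restrict_restrict measurableSet_Iio]
  congr 1
  ext y
  simp only [mem_inter_iff, mem_Iio, mem_Ioo]
  constructor
  · rintro ⟨h1, h2, -⟩; exact ⟨h2, h1⟩
  · rintro ⟨h1, h2⟩; exact ⟨h2, h1, h2.trans hx.2⟩

lemma restrict_Ioo_restrict_Ioi {x : ℝ} (hx : x ∈ Ioo (0 : ℝ) 1) :
    (volume.restrict (Ioo (0 : ℝ) 1)).restrict (Ioi x) = volume.restrict (Ioo x 1) := by
  rw [Measure.restrict_restrict measurableSet_Ioi]
  congr 1
  ext y
  simp only [mem_inter_iff, mem_Ioi, mem_Ioo]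
  constructor
  · rintro ⟨h1, -, h2⟩; exact ⟨h1, h2⟩
  · rintro ⟨h1, h2⟩; exact ⟨h1, hx.1.trans h1, h2⟩

lemma integral_indicator_Iio {x : ℝ} (hx : x ∈ Ioo (0 : ℝ) 1) (f : ℝ → ℝ) :
    ∫ s in Ioo (0 : ℝ) 1, (Iio x).indicator f s = ∫ s in (0 : ℝ)..x, f s := by
  rw [integral_indicator measurableSet_Iio, restrict_Ioo_restrict_Iio hx,
    intervalIntegral.integral_of_le hx.1.le, integral_Ioc_eq_integral_Ioo]

lemma integral_indicator_Ioi {x : ℝ} (hx : x ∈ Ioo (0 : ℝ) 1) (f : ℝ → ℝ) :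
    ∫ s in Ioo (0 : ℝ) 1, (Ioi x).indicator f s = ∫ s in x..1, f s := by
  rw [integral_indicator measurableSet_Ioi, restrict_Ioo_restrict_Ioi hx,
    intervalIntegral.integral_of_le hx.2.le, integral_Ioc_eq_integral_Ioo]

lemma ae_mem_Ioo : ∀ᵐ x ∂(volume.restrict (Ioo (0 : ℝ) 1)), x ∈ Ioo (0 : ℝ) 1 :=
  ae_restrict_mem measurableSet_Ioo

lemma measurableSet_triangle : MeasurableSet {p : ℝ × ℝ | p.2 < p.1} :=
  measurableSet_lt measurable_snd measurable_fst

/-- Fubini's theorem on the triangle `0 < s < x < 1`. -/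
lemma fubini_triangle {G h : ℝ → ℝ}
    (hG : AEStronglyMeasurable G (volume.restrict (Ioo (0 : ℝ) 1)))
    (hh : IntegrableOn h (Ioo (0 : ℝ) 1))
    (hGh : IntegrableOn (fun x => G x * ∫ s in (0 : ℝ)..x, |h s|) (Ioo (0 : ℝ) 1)) :
    IntegrableOn (fun s => h s * ∫ x in s..1, G x) (Ioo (0 : ℝ) 1) ∧
      ∫ x in Ioo (0 : ℝ) 1, G x * ∫ s in (0 : ℝ)..x, h s =
        ∫ s in Ioo (0 : ℝ) 1, h s * ∫ x in s..1, G x := by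
  set ν := volume.restrict (Ioo (0 : ℝ) 1)
  set F : ℝ → ℝ → ℝ := fun x s => {p : ℝ × ℝ | p.2 < p.1}.indicator (fun p => G p.1 * h p.2) (x, s)
  have hF1 : ∀ x, F x = fun s => G x * (Iio x).indicator h s := by
    intro x
    ext s
    by_cases hs : s < x <;> simp [F, indicator, hs]
  have hF2 : ∀ s, (fun x => F x s) = fun x => h s * (Ioi s).indicator G x := by
    intro s
    ext x
    by_cases hs : s < x <;> simp [F, indicator, hs, mul_comm]
  have hF3 : ∀ x s, ‖F x s‖ = |G x| * (Iio x).indicator (fun s => |h s|) s := by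
    intro x s
    by_cases hs : s < x <;> simp [F, indicator, hs]
  have hFint : Integrable (Function.uncurry F) (ν.prod ν) := by
    rw [integrable_prod_iff]
    · constructor
      · refine Eventually.of_forall fun x => ?_
        simp only [Function.uncurry]
        rw [hF1]
        exact (hh.indicator measurableSet_Iio).const_mul _
      · refine hGh.norm.congr ?_
        filter_upwards [ae_mem_Ioo] with x hx
        simp only [Function.uncurry, hF3]
        rw [integral_const_mul, integral_indicator_Iio hx, norm_mul, Real.norm_eq_abs,
          Real.norm_eq_abs, abs_of_nonneg (a := ∫ s in (0 : ℝ)..x, |h s|)]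
        exact intervalIntegral.integral_nonneg hx.1.le fun _ _ => abs_nonneg _
    · exact (hG.comp_fst.mul hh.aestronglyMeasurable.comp_snd).indicator measurableSet_triangle
  have hswap := integral_integral_swap hFint
  have h1 : ∫ x, ∫ s, F x s ∂ν ∂ν = ∫ x, (G x * ∫ s in (0 : ℝ)..x, h s) ∂ν := by
    refine integral_congr_ae ?_
    filter_upwards [ae_mem_Ioo] with x hx
    rw [hF1, integral_const_mul, integral_indicator_Iio hx]
  have h2 : (fun s => ∫ x, F x s ∂ν) =ᵐ[ν] fun s => h s * ∫ x in s..1, G x := by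
    filter_upwards [ae_mem_Ioo] with s hs
    rw [hF2, integral_const_mul, integral_indicator_Ioi hs]
  refine ⟨?_, ?_⟩
  · exact hFint.integral_prod_right.congr h2
  · rw [← h1, hswap]
    exact integral_congr_ae h2

lemma lintegral_Ioo_ofReal_rpow {r x y : ℝ} (hr : r ≠ -1) (hx : 0 ≤ x) (hxy : x ≤ y)
    (h : -1 < r ∨ 0 < x) :
    ∫⁻ s in Ioo x y, ENNReal.ofReal (s ^ r) =
      ENNReal.ofReal ((y ^ (r + 1) - x ^ (r + 1)) / (r + 1)) := by
  have h' : -1 < r ∨ r ≠ -1 ∧ (0 : ℝ) ∉ uIcc x y := by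
    refine h.imp_right fun h => ⟨hr, fun h0 => ?_⟩
    rw [uIcc_of_le hxy] at h0
    linarith [h0.1]
  have hint : IntervalIntegrable (fun s : ℝ => s ^ r) volume x y := by
    rcases h' with h' | h'
    · exact intervalIntegral.intervalIntegrable_rpow' h'
    · exact intervalIntegral.intervalIntegrable_rpow (Or.inr h'.2)
  rw [← integral_rpow h', intervalIntegral.integral_of_le hxy, integral_Ioc_eq_integral_Ioo,
    ofReal_integral_eq_lintegral_ofReal]
  · rwa [← IntegrableOn, ← intervalIntegrable_iff_integrableOn_Ioo_of_le hxy]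
  · filter_upwards [ae_restrict_mem measurableSet_Ioo] with s hs
    exact Real.rpow_nonneg (hx.trans hs.1.le) _

/-- The Schur test bound behind Hardy's inequality, with the weight `s ^ (1/4)`. -/
lemma sq_lintegral_le {G : ℝ → ENNReal} {x : ℝ} (hx : 0 < x)
    (hG : AEMeasurable G (volume.restrict (Ioo 0 x))) :
    (∫⁻ s in Ioo 0 x, G s) ^ 2 ≤ ENNReal.ofReal (2 * x ^ (1 / 2 : ℝ)) *
      ∫⁻ s in Ioo 0 x, G s ^ 2 * ENNReal.ofReal (s ^ (1 / 2 : ℝ)) := by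
  have hm : ∀ r : ℝ, AEMeasurable (fun s : ℝ => ENNReal.ofReal (s ^ r))
      (volume.restrict (Ioo 0 x)) := fun r => by fun_prop
  have hCS := ENNReal.lintegral_mul_le_Lp_mul_Lq (volume.restrict (Ioo 0 x))
    Real.HolderConjugate.two_two (hG.mul (hm (1 / 4))) (hm (-1 / 4))
  have h1 : ∫⁻ s in Ioo 0 x, G s = ∫⁻ s in Ioo 0 x, ((fun s => G s * ENNReal.ofReal
      (s ^ (1 / 4 : ℝ))) * fun s => ENNReal.ofReal (s ^ (-1 / 4 : ℝ))) s := by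
    refine setLIntegral_congr_fun measurableSet_Ioo fun s hs => ?_
    simp only [Pi.mul_apply]
    rw [mul_assoc, ← ENNReal.ofReal_mul (Real.rpow_nonneg hs.1.le _), ← Real.rpow_add hs.1]
    norm_num
  have h2 : ∫⁻ s in Ioo 0 x, ENNReal.ofReal (s ^ (-1 / 4 : ℝ)) ^ (2 : ℝ) =
      ENNReal.ofReal (2 * x ^ (1 / 2 : ℝ)) := by
    have h3 := lintegral_Ioo_ofReal_rpow (r := -1 / 2) (by norm_num) le_rfl hx.le
      (Or.inl (by norm_num))
    rw [Real.zero_rpow (by norm_num)] at h3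
    rw [show (2 * x ^ (1 / 2 : ℝ)) = (x ^ (-1 / 2 + 1 : ℝ) - 0) / (-1 / 2 + 1) by norm_num; ring,
      ← h3]
    refine setLIntegral_congr_fun measurableSet_Ioo fun s hs => ?_
    rw [ENNReal.ofReal_rpow_of_pos (Real.rpow_pos_of_pos hs.1 _), ← Real.rpow_mul hs.1.le]
    norm_num
  have h4 : ∫⁻ s in Ioo 0 x, ((G * fun s => ENNReal.ofReal (s ^ (1 / 4 : ℝ))) s) ^ (2 : ℝ) =
      ∫⁻ s in Ioo 0 x, G s ^ 2 * ENNReal.ofReal (s ^ (1 / 2 : ℝ)) := by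
    refine setLIntegral_congr_fun measurableSet_Ioo fun s hs => ?_
    simp only [Pi.mul_apply]
    rw [ENNReal.mul_rpow_of_nonneg _ _ (by norm_num),
      ENNReal.ofReal_rpow_of_pos (Real.rpow_pos_of_pos hs.1 _), ← Real.rpow_mul hs.1.le]
    norm_num
  rw [h1]
  refine (pow_le_pow_left' hCS 2).trans (le_of_eq ?_)
  rw [h2, h4, mul_pow, ← ENNReal.rpow_natCast, ← ENNReal.rpow_natCast, ← ENNReal.rpow_mul,
    ← ENNReal.rpow_mul]
  norm_num
  rw [mul_comm]

/-- Hardy's inequality on `(0,1)`. -/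
lemma hardy {G : ℝ → ENNReal} (hG : AEMeasurable G (volume.restrict (Ioo (0 : ℝ) 1))) :
    ∫⁻ x in Ioo (0 : ℝ) 1, ENNReal.ofReal (x ^ (-2 : ℝ)) * (∫⁻ s in Ioo 0 x, G s) ^ 2 ≤
      4 * ∫⁻ s in Ioo (0 : ℝ) 1, G s ^ 2 := by
  set ν := volume.restrict (Ioo (0 : ℝ) 1)
  set F : ℝ → ℝ → ENNReal := fun x s => {p : ℝ × ℝ | p.2 < p.1}.indicator
    (fun p => ENNReal.ofReal (2 * p.1 ^ (-3 / 2 : ℝ)) *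
      (G p.2 ^ 2 * ENNReal.ofReal (p.2 ^ (1 / 2 : ℝ)))) (x, s)
  have hF1 : ∀ x, F x = (Iio x).indicator fun s => ENNReal.ofReal (2 * x ^ (-3 / 2 : ℝ)) *
      (G s ^ 2 * ENNReal.ofReal (s ^ (1 / 2 : ℝ))) := by
    intro x
    ext s
    by_cases hs : s < x <;> simp [F, indicator, hs]
  have hF2 : ∀ s, (fun x => F x s) = (Ioi s).indicator fun x =>
      ENNReal.ofReal (2 * x ^ (-3 / 2 : ℝ)) * (G s ^ 2 * ENNReal.ofReal (s ^ (1 / 2 : ℝ))) := by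
    intro s
    ext x
    by_cases hs : s < x <;> simp [F, indicator, hs]
  have hF : AEMeasurable (Function.uncurry F) (ν.prod ν) := by
    refine AEMeasurable.indicator ?_ measurableSet_triangle
    refine AEMeasurable.mul (by fun_prop) (AEMeasurable.mul ?_ (by fun_prop))
    exact (hG.comp_snd).pow_const 2
  have hGs : ∀ x ∈ Ioo (0 : ℝ) 1, AEMeasurable G (volume.restrict (Ioo 0 x)) := fun x hx =>
    hG.mono_measure (Measure.restrict_mono (Ioo_subset_Ioo_right hx.2.le) le_rfl)
  have hm : ∀ r : ℝ, Measurable (fun s : ℝ => ENNReal.ofReal (s ^ r)) := fun r => by fun_prop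
  calc ∫⁻ x in Ioo (0 : ℝ) 1, ENNReal.ofReal (x ^ (-2 : ℝ)) * (∫⁻ s in Ioo 0 x, G s) ^ 2
      ≤ ∫⁻ x, ∫⁻ s, F x s ∂ν ∂ν := by
        refine setLIntegral_mono' measurableSet_Ioo fun x hx => ?_
        rw [hF1, lintegral_indicator measurableSet_Iio, restrict_Ioo_restrict_Iio hx,
          lintegral_const_mul' _ _ ENNReal.ofReal_ne_top]
        refine (mul_le_mul_right (sq_lintegral_le hx.1 (hGs x hx)) _).trans (le_of_eq ?_)
        rw [← mul_assoc, ← ENNReal.ofReal_mul (Real.rpow_nonneg hx.1.le _), mul_left_comm,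
          ← Real.rpow_add hx.1]
        norm_num
    _ = ∫⁻ s, ∫⁻ x, F x s ∂ν ∂ν := lintegral_lintegral_swap hF
    _ ≤ ∫⁻ s in Ioo (0 : ℝ) 1, 4 * G s ^ 2 := by
        refine setLIntegral_mono_ae' measurableSet_Ioo (Eventually.of_forall fun s hs => ?_)
        rw [hF2, lintegral_indicator measurableSet_Ioi, restrict_Ioo_restrict_Ioi hs,
          lintegral_mul_const _ (by fun_prop)]
        have h1 : ∫⁻ x in Ioo s 1, ENNReal.ofReal (2 * x ^ (-3 / 2 : ℝ)) ≤
            ENNReal.ofReal (4 * s ^ (-1 / 2 : ℝ)) := by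
          simp_rw [ENNReal.ofReal_mul (zero_le_two (α := ℝ))]
          rw [lintegral_const_mul _ (hm _), lintegral_Ioo_ofReal_rpow (by norm_num) hs.1.le hs.2.le
            (Or.inr hs.1), ← ENNReal.ofReal_mul zero_le_two]
          refine ENNReal.ofReal_le_ofReal ?_
          rw [show (-3 / 2 + 1 : ℝ) = -1 / 2 by norm_num, Real.one_rpow]
          linarith
        refine (mul_le_mul_left h1 _).trans (le_of_eq ?_)
        have h2 : 0 ≤ 4 * s ^ (-1 / 2 : ℝ) := by
          have := Real.rpow_nonneg hs.1.le (-1 / 2 : ℝ)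
          positivity
        rw [mul_left_comm, ← ENNReal.ofReal_mul h2, mul_assoc, ← Real.rpow_add hs.1]
        norm_num
        rw [mul_comm]
    _ = 4 * ∫⁻ s in Ioo (0 : ℝ) 1, G s ^ 2 := lintegral_const_mul'' _ (hG.pow_const 2)

/-! ### Weak derivatives on the unit interval -/

lemma eq_zero_of_tsupport_subset {φ : ℝ → ℝ} (hs : tsupport φ ⊆ Ioo (0 : ℝ) 1) {x : ℝ}
    (hx : x ∉ Ioo (0 : ℝ) 1) : φ x = 0 :=
  image_eq_zero_of_notMem_tsupport fun h => hx (hs h)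

lemma setIntegral_Ioo_eq_integral {φ : ℝ → ℝ} (hs : tsupport φ ⊆ Ioo (0 : ℝ) 1) (f : ℝ → ℝ) :
    ∫ x in Ioo (0 : ℝ) 1, f x * φ x = ∫ x, f x * φ x :=
  setIntegral_eq_integral_of_forall_compl_eq_zero fun x hx => by
    rw [eq_zero_of_tsupport_subset hs hx, mul_zero]

/-- A test function with zero mean is the derivative of a test function. -/
lemma exists_test_primitive {χ : ℝ → ℝ} (hχ : ContDiff ℝ ∞ χ) (hc : HasCompactSupport χ)
    (hs : tsupport χ ⊆ Ioo (0 : ℝ) 1) (h0 : ∫ x in Ioo (0 : ℝ) 1, χ x = 0) :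
    ∃ φ : ℝ → ℝ, ContDiff ℝ ∞ φ ∧ HasCompactSupport φ ∧ tsupport φ ⊆ Ioo (0 : ℝ) 1 ∧
      deriv φ = χ := by
  set φ : ℝ → ℝ := fun x => ∫ s in (0 : ℝ)..x, χ s
  have hderiv : ∀ x, HasDerivAt φ (χ x) x := fun x =>
    intervalIntegral.integral_hasDerivAt_right (hχ.continuous.intervalIntegrable _ _)
      (hχ.continuous.stronglyMeasurableAtFilter _ _) hχ.continuous.continuousAt
  have hd : deriv φ = χ := funext fun x => (hderiv x).deriv
  have hK : IsCompact (insert (1 / 2 : ℝ) (tsupport χ)) := IsCompact.insert hc _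
  have hKs : insert (1 / 2 : ℝ) (tsupport χ) ⊆ Ioo (0 : ℝ) 1 :=
    insert_subset (by norm_num) hs
  obtain ⟨α, hα, hα'⟩ := hK.exists_isLeast (insert_nonempty _ _)
  obtain ⟨γ, hγ, hγ'⟩ := hK.exists_isGreatest (insert_nonempty _ _)
  have hα0 := hKs hα
  have hγ0 := hKs hγ
  have hlt : ∀ x, x < α → χ x = 0 := fun x hx => image_eq_zero_of_notMem_tsupport fun h =>
    absurd (hα' (mem_insert_of_mem _ h)) (not_le.2 hx)
  have hgt : ∀ x, γ < x → χ x = 0 := fun x hx => image_eq_zero_of_notMem_tsupport fun h =>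
    absurd (hγ' (mem_insert_of_mem _ h)) (not_le.2 hx)
  have hsupp : tsupport φ ⊆ Icc α γ := by
    refine closure_minimal (fun x hx => ?_) isClosed_Icc
    by_contra hxn
    apply hx
    rcases lt_or_ge x α with h | h
    · refine (intervalIntegral.integral_congr (g := fun _ => (0 : ℝ)) fun s hs => ?_).trans
        (by simp)
      refine hlt s (lt_of_le_of_lt hs.2 ?_)
      exact max_lt hα0.1 h
    · have h' : γ < x := not_le.1 fun h' => hxn ⟨h, h'⟩
      have h1 : ∫ s in (0 : ℝ)..1, χ s = 0 := by
        rw [intervalIntegral.integral_of_le zero_le_one, integral_Ioc_eq_integral_Ioo, h0]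
      have h2 : ∫ s in (1 : ℝ)..x, χ s = 0 := by
        refine (intervalIntegral.integral_congr (g := fun _ => (0 : ℝ)) fun s hs => ?_).trans
          (by simp)
        exact hgt s (lt_of_lt_of_le (lt_min hγ0.2 h') hs.1)
      change (∫ s in (0 : ℝ)..x, χ s) = 0
      rw [← intervalIntegral.integral_add_adjacent_intervals
        (hχ.continuous.intervalIntegrable 0 1) (hχ.continuous.intervalIntegrable 1 x), h1, h2,
        add_zero]
  refine ⟨φ, ?_, ?_, hsupp.trans fun x hx => ⟨hα0.1.trans_le hx.1, hx.2.trans_lt hγ0.2⟩, hd⟩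
  · rw [contDiff_infty_iff_deriv]
    exact ⟨fun x => (hderiv x).differentiableAt, by rwa [hd]⟩
  · exact isCompact_Icc.of_isClosed_subset (isClosed_tsupport φ) hsupp

/-- The lemma of du Bois-Reymond. -/
lemma ae_eq_const_of_weakDeriv_zero {h : ℝ → ℝ} (hh : LocallyIntegrableOn h (Ioo (0 : ℝ) 1))
    (h0 : ∀ φ : ℝ → ℝ, ContDiff ℝ ∞ φ → HasCompactSupport φ → tsupport φ ⊆ Ioo (0 : ℝ) 1 →
      ∫ x in Ioo (0 : ℝ) 1, h x * deriv φ x = 0) :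
    ∃ c : ℝ, h =ᵐ[volume.restrict (Ioo (0 : ℝ) 1)] fun _ => c := by
  obtain ⟨ψ₀, hs₀, hc₀, hψ₀, hr₀, h1₀⟩ := exists_contDiff_tsupport_subset (n := ⊤)
    (isOpen_Ioo.mem_nhds (show (1 / 2 : ℝ) ∈ Ioo (0 : ℝ) 1 by norm_num))
  have hI : 0 < ∫ x, ψ₀ x :=
    hψ₀.continuous.integral_pos_of_hasCompactSupport_nonneg_nonzero hc₀
      (fun x => (hr₀ ⟨x, rfl⟩).1) (x := 1 / 2) (by rw [h1₀]; norm_num)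
  set I := ∫ x, ψ₀ x
  have hint : ∀ {ψ : ℝ → ℝ}, ContDiff ℝ ∞ ψ → HasCompactSupport ψ → Integrable ψ := fun hψ hc =>
    hψ.continuous.integrable_of_hasCompactSupport hc
  have hIoo : ∀ {ψ : ℝ → ℝ}, tsupport ψ ⊆ Ioo (0 : ℝ) 1 →
      ∫ x in Ioo (0 : ℝ) 1, ψ x = ∫ x, ψ x := fun hs =>
    setIntegral_eq_integral_of_forall_compl_eq_zero fun x hx =>
      eq_zero_of_tsupport_subset hs hx
  refine ⟨(∫ x in Ioo (0 : ℝ) 1, h x * ψ₀ x) / I, ?_⟩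
  set c := (∫ x in Ioo (0 : ℝ) 1, h x * ψ₀ x) / I with hcdef
  have hloc : LocallyIntegrableOn (fun x => h x - c) (Ioo (0 : ℝ) 1) :=
    hh.sub ((continuous_const.locallyIntegrable).locallyIntegrableOn _)
  have key := isOpen_Ioo.ae_eq_zero_of_integral_contDiff_smul_eq_zero hloc ?_
  · rw [Filter.EventuallyEq, ae_restrict_iff' measurableSet_Ioo]
    filter_upwards [key] with x hx hxm
    exact sub_eq_zero.1 (hx hxm)
  intro ψ hψ hc hs
  set χ : ℝ → ℝ := fun x => ψ x - (∫ x, ψ x) / I * ψ₀ x with hχdef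
  have hχs : tsupport χ ⊆ tsupport ψ ∪ tsupport ψ₀ := by
    refine closure_minimal (fun x hx => ?_) ((isClosed_tsupport _).union (isClosed_tsupport _))
    by_contra hxn
    rw [mem_union, not_or] at hxn
    exact hx (by simp [hχdef, image_eq_zero_of_notMem_tsupport hxn.1,
      image_eq_zero_of_notMem_tsupport hxn.2])
  have hχIoo := hχs.trans (union_subset hs hs₀)
  obtain ⟨φ, hφ, hφc, hφs, hφd⟩ := exists_test_primitive (χ := χ)
    (hψ.sub (contDiff_const.mul hψ₀))
    ((hc.isCompact.union hc₀.isCompact).of_isClosed_subset (isClosed_tsupport _) hχs) hχIoo (by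
      rw [hIoo hχIoo, integral_sub (hint hψ hc) ((hint hψ₀ hc₀).const_mul _), integral_const_mul]
      change _ - _ / I * I = 0
      rw [div_mul_cancel₀ _ hI.ne', sub_self])
  have h2 := h0 φ hφ hφc hφs
  have i1 := integrable_mul_of_compactSupport hh hψ.continuous hc hs
  have i2 := integrable_mul_of_compactSupport hh hψ₀.continuous hc₀ hs₀
  have h3 : ∫ x in Ioo (0 : ℝ) 1, h x * χ x = (∫ x in Ioo (0 : ℝ) 1, h x * ψ x) -
      (∫ x, ψ x) / I * ∫ x in Ioo (0 : ℝ) 1, h x * ψ₀ x := by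
    rw [← integral_const_mul, ← integral_sub i1 (i2.const_mul _)]
    congr 1
    ext x
    simp only [hχdef]
    ring
  rw [hφd, h3] at h2
  have h4 : ∫ x, ψ x • (h x - c) = ∫ x in Ioo (0 : ℝ) 1, (h x * ψ x - c * ψ x) := by
    have := setIntegral_Ioo_eq_integral hs (fun x => h x - c)
    simp only [sub_mul] at this
    rw [this]
    congr 1
    ext x
    simp only [smul_eq_mul]
    ring
  rw [h4, integral_sub i1 ((hint hψ hc).restrict.const_mul c), integral_const_mul, hIoo hs,
    hcdef]
  have : (∫ x, ψ x) / I * (∫ x in Ioo (0 : ℝ) 1, h x * ψ₀ x) =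
    (∫ x in Ioo (0 : ℝ) 1, h x * ψ₀ x) / I * ∫ x, ψ x := by ring
  rw [← this]
  exact h2

lemma IsWeakDeriv.sub_ae_eq_const {f f' g : ℝ → ℝ} (h : IsWeakDeriv f g)
    (h' : IsWeakDeriv f' g) :
    ∃ c : ℝ, f =ᵐ[volume.restrict (Ioo (0 : ℝ) 1)] fun x => f' x + c := by
  obtain ⟨c, hc⟩ := ae_eq_const_of_weakDeriv_zero (h.1.sub h'.1) fun φ hφ hφc hφs => by
    have hd : Continuous (deriv φ) := hφ.continuous_deriv (by simp)
    have hds := (tsupport_deriv_sub φ).trans hφs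
    simp only [Pi.sub_apply, sub_mul]
    rw [integral_sub (integrable_mul_of_compactSupport h.1 hd hφc.deriv hds)
      (integrable_mul_of_compactSupport h'.1 hd hφc.deriv hds), h.2.2 φ hφ hφc hφs,
      h'.2.2 φ hφ hφc hφs, sub_self]
  refine ⟨c, ?_⟩
  filter_upwards [hc] with x hx
  rw [← hx, Pi.sub_apply, add_sub_cancel]

lemma IsWeakDeriv.unique {f g g' : ℝ → ℝ} (h : IsWeakDeriv f g) (h' : IsWeakDeriv f g') :
    g =ᵐ[volume.restrict (Ioo (0 : ℝ) 1)] g' := by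
  have key := isOpen_Ioo.ae_eq_zero_of_integral_contDiff_smul_eq_zero (h.2.1.sub h'.2.1)
    fun φ hφ hφc hφs => by
      have h1 := setIntegral_Ioo_eq_integral hφs (fun x => g x - g' x)
      simp only [sub_mul] at h1
      simp only [Pi.sub_apply, smul_eq_mul, mul_comm (φ _), sub_mul]
      rw [← h1, integral_sub (integrable_mul_of_compactSupport h.2.1 hφ.continuous hφc hφs)
        (integrable_mul_of_compactSupport h'.2.1 hφ.continuous hφc hφs)]
      linarith [h.2.2 φ hφ hφc hφs, h'.2.2 φ hφ hφc hφs]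
  rw [Filter.EventuallyEq, ae_restrict_iff' measurableSet_Ioo]
  filter_upwards [key] with x hx hxm
  exact sub_eq_zero.1 (hx hxm)

lemma IsWeakDeriv.congr_left {f f' g : ℝ → ℝ} (h : IsWeakDeriv f g)
    (hff : f =ᵐ[volume.restrict (Ioo (0 : ℝ) 1)] f')
    (hf' : LocallyIntegrableOn f' (Ioo (0 : ℝ) 1)) : IsWeakDeriv f' g := by
  refine ⟨hf', h.2.1, fun φ hφ hφc hφs => ?_⟩
  rw [← h.2.2 φ hφ hφc hφs]
  refine integral_congr_ae ?_
  filter_upwards [hff] with x hx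
  rw [hx]

lemma intervalIntegrable_of_Ioo {g : ℝ → ℝ} (hg : IntegrableOn g (Ioo (0 : ℝ) 1)) :
    IntervalIntegrable g volume 0 1 := by
  rwa [intervalIntegrable_iff_integrableOn_Ioo_of_le zero_le_one]

lemma continuousOn_primitive {g : ℝ → ℝ} (hg : IntegrableOn g (Ioo (0 : ℝ) 1)) :
    ContinuousOn (fun x => ∫ s in (0 : ℝ)..x, g s) (Icc 0 1) := by
  have := intervalIntegral.continuousOn_primitive_interval' (intervalIntegrable_of_Ioo hg)
    (left_mem_uIcc)
  rwa [uIcc_of_le zero_le_one] at this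

lemma integral_deriv_test {φ : ℝ → ℝ} (hφ : ContDiff ℝ ∞ φ) (x y : ℝ) :
    ∫ s in x..y, deriv φ s = φ y - φ x :=
  intervalIntegral.integral_deriv_eq_sub
    (fun s _ => (hφ.differentiable (by simp)).differentiableAt)
    ((hφ.continuous_deriv (by simp)).intervalIntegrable _ _)

lemma isWeakDeriv_primitive {g : ℝ → ℝ} (hg : IntegrableOn g (Ioo (0 : ℝ) 1)) :
    IsWeakDeriv (fun x => ∫ s in (0 : ℝ)..x, g s) g := by
  have habs : IntegrableOn (fun s => |g s|) (Ioo (0 : ℝ) 1) := hg.norm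
  have hloc : ∀ {f : ℝ → ℝ}, IntegrableOn f (Ioo (0 : ℝ) 1) → LocallyIntegrableOn
      (fun x => ∫ s in (0 : ℝ)..x, f s) (Ioo (0 : ℝ) 1) := fun hf =>
    ((continuousOn_primitive hf).mono Ioo_subset_Icc_self).locallyIntegrableOn measurableSet_Ioo
  refine ⟨hloc hg, hg.locallyIntegrableOn, fun φ hφ hφc hφs => ?_⟩
  have hd : Continuous (deriv φ) := hφ.continuous_deriv (by simp)
  have hds := (tsupport_deriv_sub φ).trans hφs
  have hint := integrable_mul_of_compactSupport (hloc habs) hd hφc.deriv hds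
  have h1 := (fubini_triangle (G := deriv φ) (h := g) hd.aestronglyMeasurable hg
    (by simpa only [IntegrableOn, mul_comm] using hint)).2
  simp only [mul_comm (deriv φ _)] at h1
  rw [h1, ← integral_neg]
  refine setIntegral_congr_fun measurableSet_Ioo fun s _ => ?_
  rw [integral_deriv_test hφ, eq_zero_of_tsupport_subset hφs (x := 1) (by simp)]
  ring

/-- A function with integrable weak derivative `g` that is continuous on `[0,1]` and vanishes at `0`
is `∫₀ˣ g`. -/
lemma IsWeakDeriv.ae_eq_primitive {f g : ℝ → ℝ} (h : IsWeakDeriv f g)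
    (hg : IntegrableOn g (Ioo (0 : ℝ) 1)) (hf : ContinuousOn f (Icc 0 1)) (h0 : f 0 = 0) :
    f =ᵐ[volume.restrict (Ioo (0 : ℝ) 1)] fun x => ∫ s in (0 : ℝ)..x, g s := by
  obtain ⟨c, hc⟩ := h.sub_ae_eq_const (isWeakDeriv_primitive hg)
  have h1 : ContinuousOn (fun x => (∫ s in (0 : ℝ)..x, g s) + c) (Icc 0 1) :=
    (continuousOn_primitive hg).add continuousOn_const
  have h2 := Measure.eqOn_open_of_ae_eq hc isOpen_Ioo (hf.mono Ioo_subset_Icc_self)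
    (h1.mono Ioo_subset_Icc_self)
  have h3 := h2.of_subset_closure hf h1 Ioo_subset_Icc_self
    (by rw [closure_Ioo zero_ne_one])
  have h4 := h3 (left_mem_Icc.2 zero_le_one)
  simp only [h0, intervalIntegral.integral_same, zero_add] at h4
  filter_upwards [hc] with x hx
  rw [hx, ← h4, add_zero]

lemma HasValueAt.unique {f : ℝ → ℝ} {p q : ℝ} (hp : HasValueAt f 1 p) (hq : HasValueAt f 1 q) :
    p = q := by
  obtain ⟨v, hv, hfv, rfl⟩ := hp
  obtain ⟨w, hw, hfw, rfl⟩ := hq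
  have h1 := Measure.eqOn_open_of_ae_eq (hfv.symm.trans hfw) isOpen_Ioo
    (hv.mono (subset_insert _ _)) (hw.mono (subset_insert _ _))
  refine h1.of_subset_closure hv hw (subset_insert _ _) ?_ (mem_insert _ _)
  rw [closure_Ioo zero_ne_one]
  exact insert_subset (by simp) Ioo_subset_Icc_self

variable {a b d : ℝ → ℝ} {K₁ K₂ : ℝ}

/-! ### Bounds on the coefficients and the weighted measures -/

lemma eta_pos (a b : ℝ → ℝ) (x : ℝ) : 0 < eta a b x := Real.exp_pos _

lemma exists_rpow_div_le {f : ℝ → ℝ} {K : ℝ} (hf : ContinuousOn f (Icc 0 1))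
    (hpos : ∀ x ∈ Ioc (0 : ℝ) 1, 0 < f x)
    (hmono : ∃ δ ∈ Ioc (0 : ℝ) 1, MonotoneOn (fun x => x ^ K / f x) (Ioo 0 δ)) :
    ∃ C : ℝ, 0 < C ∧ ∀ x ∈ Ioo (0 : ℝ) 1, x ^ K / f x ≤ C := by
  obtain ⟨δ, hδ, hm⟩ := hmono
  have hc : ContinuousOn (fun x => x ^ K / f x) (Icc (δ / 2) 1) := by
    intro x hx
    have hx0 : 0 < x := lt_of_lt_of_le (by linarith [hδ.1]) hx.1
    refine ContinuousWithinAt.div ?_ ?_ (hpos x ⟨hx0, hx.2⟩).ne'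
    · exact (Real.continuousAt_rpow_const x K (Or.inl hx0.ne')).continuousWithinAt
    · exact (hf x ⟨hx0.le, hx.2⟩).mono (Icc_subset_Icc_left (by linarith [hδ.1]))
  obtain ⟨C, hC⟩ := (isCompact_Icc.image_of_continuousOn hc).bddAbove
  have hδ2 : δ / 2 ∈ Icc (δ / 2) 1 := ⟨le_rfl, by linarith [hδ.1, hδ.2]⟩
  refine ⟨max C 1, by positivity, fun x hx => le_max_of_le_left ?_⟩
  rcases le_total (δ / 2) x with h | h
  · exact hC ⟨x, ⟨h, hx.2.le⟩, rfl⟩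
  · exact (hm ⟨hx.1, by linarith [hδ.1]⟩ ⟨by linarith [hδ.1], by linarith [hδ.1]⟩ h).trans
      (hC ⟨δ / 2, hδ2, rfl⟩)

namespace CoeffHyp

lemma continuousOn_eta (hc : CoeffHyp a b d K₁ K₂) : ContinuousOn (eta a b) (Icc 0 1) := by
  have h := intervalIntegral.continuousOn_primitive_interval'
    (intervalIntegrable_of_Ioo hc.integrable_drift) (a := 1 / 2)
    (by rw [uIcc_of_le zero_le_one]; norm_num)
  rw [uIcc_of_le zero_le_one] at h
  exact Real.continuous_exp.comp_continuousOn h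

lemma exists_eta_bounds (hc : CoeffHyp a b d K₁ K₂) :
    ∃ m M : ℝ, 0 < m ∧ 0 < M ∧ ∀ x ∈ Icc (0 : ℝ) 1, m ≤ eta a b x ∧ eta a b x ≤ M := by
  have hne : (Icc (0 : ℝ) 1).Nonempty := ⟨0, by simp⟩
  obtain ⟨x, -, hx⟩ := isCompact_Icc.exists_isMinOn hne hc.continuousOn_eta
  obtain ⟨y, -, hy⟩ := isCompact_Icc.exists_isMaxOn hne hc.continuousOn_eta
  exact ⟨_, _, eta_pos a b x, eta_pos a b y, fun z hz => ⟨hx hz, hy hz⟩⟩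

lemma sig_pos (hc : CoeffHyp a b d K₁ K₂) {x : ℝ} (hx : x ∈ Ioo (0 : ℝ) 1) : 0 < sig a b x :=
  div_pos (hc.a_pos x (Ioo_subset_Ioc_self hx)) (eta_pos a b x)

lemma continuousOn_sig (hc : CoeffHyp a b d K₁ K₂) : ContinuousOn (sig a b) (Icc 0 1) :=
  hc.cont_a.div hc.continuousOn_eta fun x _ => (eta_pos a b x).ne'

lemma continuousOn_one_div_sig (hc : CoeffHyp a b d K₁ K₂) :
    ContinuousOn (fun x => 1 / sig a b x) (Ioo 0 1) :=
  continuousOn_const.div (hc.continuousOn_sig.mono Ioo_subset_Icc_self) fun _ hx =>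
    (hc.sig_pos hx).ne'

lemma aemeasurable_eta (hc : CoeffHyp a b d K₁ K₂) :
    AEMeasurable (fun x => ENNReal.ofReal (eta a b x)) (volume.restrict (Ioo (0 : ℝ) 1)) :=
  ((hc.continuousOn_eta.mono Ioo_subset_Icc_self).aemeasurable measurableSet_Ioo).ennreal_ofReal

lemma aemeasurable_one_div_sig (hc : CoeffHyp a b d K₁ K₂) :
    AEMeasurable (fun x => ENNReal.ofReal (1 / sig a b x)) (volume.restrict (Ioo (0 : ℝ) 1)) :=
  (hc.continuousOn_one_div_sig.aemeasurable measurableSet_Ioo).ennreal_ofReal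

lemma ae_muSig (hc : CoeffHyp a b d K₁ K₂) :
    ae (muSig a b) = ae (volume.restrict (Ioo (0 : ℝ) 1)) := by
  refine le_antisymm (withDensity_absolutelyContinuous _ _).ae_le
    (withDensity_absolutelyContinuous' hc.aemeasurable_one_div_sig ?_).ae_le
  filter_upwards [ae_mem_Ioo] with x hx
  rw [ne_eq, ENNReal.ofReal_eq_zero, not_le]
  exact one_div_pos.2 (hc.sig_pos hx)

lemma ae_muEta (hc : CoeffHyp a b d K₁ K₂) :
    ae (muEta a b) = ae (volume.restrict (Ioo (0 : ℝ) 1)) := by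
  refine le_antisymm (withDensity_absolutelyContinuous _ _).ae_le
    (withDensity_absolutelyContinuous' hc.aemeasurable_eta (Eventually.of_forall fun x => ?_)).ae_le
  rw [ne_eq, ENNReal.ofReal_eq_zero, not_le]
  exact eta_pos a b x

lemma integral_muSig (hc : CoeffHyp a b d K₁ K₂) (f : ℝ → ℝ) :
    ∫ x, f x ∂muSig a b = ∫ x in Ioo (0 : ℝ) 1, f x / sig a b x := by
  rw [muSig, integral_withDensity_eq_integral_toReal_smul₀ hc.aemeasurable_one_div_sig
    (Eventually.of_forall fun _ => ENNReal.ofReal_lt_top)]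
  refine setIntegral_congr_fun measurableSet_Ioo fun x hx => ?_
  rw [ENNReal.toReal_ofReal (one_div_pos.2 (hc.sig_pos hx)).le, smul_eq_mul, one_div_mul_eq_div]

lemma integrable_muSig (hc : CoeffHyp a b d K₁ K₂) {f : ℝ → ℝ} :
    Integrable f (muSig a b) ↔ IntegrableOn (fun x => f x / sig a b x) (Ioo (0 : ℝ) 1) := by
  rw [muSig, integrable_withDensity_iff_integrable_smul₀' hc.aemeasurable_one_div_sig
    (Eventually.of_forall fun _ => ENNReal.ofReal_lt_top)]
  refine integrable_congr ?_
  filter_upwards [ae_mem_Ioo] with x hx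
  rw [ENNReal.toReal_ofReal (one_div_pos.2 (hc.sig_pos hx)).le, smul_eq_mul, one_div_mul_eq_div]

lemma integral_muEta (hc : CoeffHyp a b d K₁ K₂) (f : ℝ → ℝ) :
    ∫ x, f x ∂muEta a b = ∫ x in Ioo (0 : ℝ) 1, eta a b x * f x := by
  rw [muEta, integral_withDensity_eq_integral_toReal_smul₀ hc.aemeasurable_eta
    (Eventually.of_forall fun _ => ENNReal.ofReal_lt_top)]
  simp only [ENNReal.toReal_ofReal (eta_pos a b _).le, smul_eq_mul]

lemma integrable_muEta (hc : CoeffHyp a b d K₁ K₂) {f : ℝ → ℝ} :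
    Integrable f (muEta a b) ↔ IntegrableOn (fun x => eta a b x * f x) (Ioo (0 : ℝ) 1) := by
  rw [muEta, integrable_withDensity_iff_integrable_smul₀' hc.aemeasurable_eta
    (Eventually.of_forall fun _ => ENNReal.ofReal_lt_top)]
  simp only [ENNReal.toReal_ofReal (eta_pos a b _).le, smul_eq_mul]
  rfl

lemma muEta_le (hc : CoeffHyp a b d K₁ K₂) : ∃ M : ENNReal, M ≠ ⊤ ∧
    muEta a b ≤ M • volume.restrict (Ioo (0 : ℝ) 1) := by
  obtain ⟨m, M, -, -, h⟩ := hc.exists_eta_bounds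
  refine ⟨ENNReal.ofReal M, ENNReal.ofReal_ne_top, ?_⟩
  rw [muEta, ← withDensity_const]
  refine withDensity_mono ?_
  filter_upwards [ae_mem_Ioo] with x hx
  exact ENNReal.ofReal_le_ofReal (h x (Ioo_subset_Icc_self hx)).2

lemma le_muEta (hc : CoeffHyp a b d K₁ K₂) : ∃ M : ENNReal, M ≠ ⊤ ∧
    volume.restrict (Ioo (0 : ℝ) 1) ≤ M • muEta a b := by
  obtain ⟨m, M, hm, -, h⟩ := hc.exists_eta_bounds
  refine ⟨ENNReal.ofReal m⁻¹, ENNReal.ofReal_ne_top, ?_⟩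
  rw [muEta, ← withDensity_smul' _ _ ENNReal.ofReal_ne_top]
  conv_lhs => rw [← withDensity_one (μ := volume.restrict (Ioo (0 : ℝ) 1))]
  refine withDensity_mono ?_
  filter_upwards [ae_mem_Ioo] with x hx
  rw [Pi.one_apply, Pi.smul_apply, smul_eq_mul, ← ENNReal.ofReal_mul (by positivity),
    ← ENNReal.ofReal_one]
  refine ENNReal.ofReal_le_ofReal ?_
  rw [inv_mul_eq_div, one_le_div hm]
  exact (h x (Ioo_subset_Icc_self hx)).1

lemma memLp_muEta (hc : CoeffHyp a b d K₁ K₂) {f : ℝ → ℝ} :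
    MemLp f 2 (muEta a b) ↔ MemLp f 2 (volume.restrict (Ioo (0 : ℝ) 1)) := by
  obtain ⟨M, hM, hM'⟩ := hc.muEta_le
  obtain ⟨m, hm, hm'⟩ := hc.le_muEta
  exact ⟨fun h => h.of_measure_le_smul hm hm', fun h => h.of_measure_le_smul hM hM'⟩

lemma integrableOn_coe (hc : CoeffHyp a b d K₁ K₂) (g : Lp ℝ 2 (muEta a b)) :
    IntegrableOn g (Ioo (0 : ℝ) 1) :=
  (hc.memLp_muEta.1 (Lp.memLp g)).integrable one_le_two

lemma intervalIntegrable_coe (hc : CoeffHyp a b d K₁ K₂) (g : Lp ℝ 2 (muEta a b)) {x : ℝ}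
    (hx : x ∈ Icc (0 : ℝ) 1) : IntervalIntegrable g volume 0 x :=
  (intervalIntegrable_of_Ioo (hc.integrableOn_coe g)).mono_set
    (by rw [uIcc_of_le hx.1, uIcc_of_le zero_le_one]; exact Icc_subset_Icc_right hx.2)

end CoeffHyp

lemma primitive_congr {f g : ℝ → ℝ} (h : f =ᵐ[volume.restrict (Ioo (0 : ℝ) 1)] g) {x : ℝ}
    (hx : x ∈ Icc (0 : ℝ) 1) : ∫ s in (0 : ℝ)..x, f s = ∫ s in (0 : ℝ)..x, g s := by
  rw [intervalIntegral.integral_of_le hx.1, intervalIntegral.integral_of_le hx.1,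
    integral_Ioc_eq_integral_Ioo, integral_Ioc_eq_integral_Ioo]
  exact integral_congr_ae (ae_restrict_of_ae_restrict_of_subset (Ioo_subset_Ioo_right hx.2) h)

/-! ### Weighted primitives as bounded operators, and Green's formula -/

namespace CoeffHyp

/-- Hardy's inequality makes `g ↦ w(x) ∫₀ˣ g` bounded into `L²(dx/σ)` as soon as
`x² w² / σ` is bounded. -/
lemma exists_weighted_primitive (hc : CoeffHyp a b d K₁ K₂) {w : ℝ → ℝ}
    (hw : ContinuousOn w (Ioo 0 1)) {C : ℝ}
    (hC : ∀ x ∈ Ioo (0 : ℝ) 1, x ^ (2 : ℝ) * w x ^ 2 / sig a b x ≤ C) :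
    ∃ T : Lp ℝ 2 (muEta a b) →L[ℝ] L2w a b, ∀ g,
      T g =ᵐ[volume.restrict (Ioo (0 : ℝ) 1)] fun x => w x * ∫ s in (0 : ℝ)..x, g s := by
  obtain ⟨m, hm, hm'⟩ := hc.le_muEta
  set ν := volume.restrict (Ioo (0 : ℝ) 1)
  set D : ENNReal := ENNReal.ofReal C * (4 * m)
  have hD : D ≠ ⊤ := ENNReal.mul_ne_top ENNReal.ofReal_ne_top (ENNReal.mul_ne_top (by simp) hm)
  have hbound : ∀ g : Lp ℝ 2 (muEta a b),
      ∫⁻ x, ‖w x * ∫ s in (0 : ℝ)..x, g s‖ₑ ^ (2 : ℝ) ∂muSig a b ≤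
        D * ∫⁻ x, ‖g x‖ₑ ^ (2 : ℝ) ∂muEta a b := by
    intro g
    have hgm : AEMeasurable (fun s => ‖g s‖ₑ) ν :=
      (hc.integrableOn_coe g).aestronglyMeasurable.enorm
    rw [muSig, lintegral_withDensity_eq_lintegral_mul_non_measurable₀ _
      hc.aemeasurable_one_div_sig (Eventually.of_forall fun _ => ENNReal.ofReal_lt_top)]
    calc ∫⁻ x in Ioo (0 : ℝ) 1, ((fun x => ENNReal.ofReal (1 / sig a b x)) * fun x =>
          ‖w x * ∫ s in (0 : ℝ)..x, g s‖ₑ ^ (2 : ℝ)) x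
        ≤ ∫⁻ x in Ioo (0 : ℝ) 1, ENNReal.ofReal C *
            (ENNReal.ofReal (x ^ (-2 : ℝ)) * (∫⁻ s in Ioo 0 x, ‖g s‖ₑ) ^ 2) := by
          refine setLIntegral_mono' measurableSet_Ioo fun x hx => ?_
          have h1 : ‖∫ s in (0 : ℝ)..x, g s‖ₑ ≤ ∫⁻ s in Ioo 0 x, ‖g s‖ₑ := by
            rw [intervalIntegral.integral_of_le hx.1.le, integral_Ioc_eq_integral_Ioo]
            exact enorm_integral_le_lintegral_enorm _
          have h2 : ENNReal.ofReal (1 / sig a b x) * ‖w x‖ₑ ^ 2 ≤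
              ENNReal.ofReal C * ENNReal.ofReal (x ^ (-2 : ℝ)) := by
            rw [Real.enorm_eq_ofReal_abs, ← ENNReal.ofReal_pow (abs_nonneg _), sq_abs,
              ← ENNReal.ofReal_mul (one_div_pos.2 (hc.sig_pos hx)).le,
              ← ENNReal.ofReal_mul' (Real.rpow_nonneg hx.1.le _)]
            refine ENNReal.ofReal_le_ofReal ?_
            have h3 := mul_le_mul_of_nonneg_right (hC x hx) (Real.rpow_nonneg hx.1.le (-2))
            refine le_trans (le_of_eq ?_) h3
            rw [Real.rpow_neg hx.1.le]
            have : x ^ (2 : ℝ) ≠ 0 := (Real.rpow_pos_of_pos hx.1 _).ne'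
            have := (hc.sig_pos hx).ne'
            field_simp
          rw [Pi.mul_apply, enorm_mul, ENNReal.mul_rpow_of_nonneg _ _ zero_le_two, ← mul_assoc,
            ← mul_assoc, ENNReal.rpow_two, ENNReal.rpow_two]
          exact mul_le_mul' h2 (pow_le_pow_left' h1 2)
      _ ≤ ENNReal.ofReal C * (4 * ∫⁻ s in Ioo (0 : ℝ) 1, ‖g s‖ₑ ^ 2) := by
          rw [lintegral_const_mul' _ _ ENNReal.ofReal_ne_top]
          exact mul_le_mul_right (hardy hgm) _
      _ ≤ ENNReal.ofReal C * (4 * (m * ∫⁻ x, ‖g x‖ₑ ^ (2 : ℝ) ∂muEta a b)) := by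
          refine mul_le_mul_right (mul_le_mul_right ?_ _) _
          rw [← smul_eq_mul m, ← lintegral_smul_measure]
          simp only [ENNReal.rpow_two]
          exact lintegral_mono' hm' le_rfl
      _ = D * ∫⁻ x, ‖g x‖ₑ ^ (2 : ℝ) ∂muEta a b := by
          simp only [D, mul_assoc]
  have hnorm : ∀ g : Lp ℝ 2 (muEta a b),
      eLpNorm (fun x => w x * ∫ s in (0 : ℝ)..x, g s) 2 (muSig a b) ≤
        D ^ (1 / 2 : ℝ) * eLpNorm g 2 (muEta a b) := by
    intro g
    rw [eLpNorm_eq_lintegral_rpow_enorm_toReal (by simp) (by simp),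
      eLpNorm_eq_lintegral_rpow_enorm_toReal (by simp) (by simp), ENNReal.toReal_ofNat,
      ← ENNReal.mul_rpow_of_nonneg _ _ (by norm_num)]
    exact ENNReal.rpow_le_rpow (hbound g) (by norm_num)
  have hD2 : D ^ (1 / 2 : ℝ) ≠ ⊤ := ENNReal.rpow_ne_top_of_nonneg (by norm_num) hD
  have hmem : ∀ g : Lp ℝ 2 (muEta a b),
      MemLp (fun x => w x * ∫ s in (0 : ℝ)..x, g s) 2 (muSig a b) := by
    intro g
    refine ⟨?_, (hnorm g).trans_lt (ENNReal.mul_lt_top hD2.lt_top (Lp.eLpNorm_lt_top g))⟩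
    have : AEStronglyMeasurable (fun x => w x * ∫ s in (0 : ℝ)..x, g s) ν :=
      (hw.mul ((continuousOn_primitive (hc.integrableOn_coe g)).mono
        Ioo_subset_Icc_self)).aestronglyMeasurable measurableSet_Ioo
    exact this.mono_ac (withDensity_absolutelyContinuous _ _)
  have hcoe : ∀ g, ((hmem g).toLp _ : ℝ → ℝ) =ᵐ[ν] fun x => w x * ∫ s in (0 : ℝ)..x, g s := by
    intro g
    have := (hmem g).coeFn_toLp
    rwa [Filter.EventuallyEq, hc.ae_muSig] at this
  have hcong : ∀ {f : ℝ → ℝ} {g : ℝ → ℝ}, f =ᵐ[muEta a b] g → f =ᵐ[ν] g := fun h => by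
    rwa [Filter.EventuallyEq, hc.ae_muEta] at h
  let T₀ : Lp ℝ 2 (muEta a b) →ₗ[ℝ] L2w a b :=
    { toFun := fun g => (hmem g).toLp _
      map_add' := fun g h => by
        refine Lp.ext ?_
        have h1 := Lp.coeFn_add ((hmem g).toLp _) ((hmem h).toLp _)
        have h2 := hcong (Lp.coeFn_add g h)
        rw [Filter.EventuallyEq, hc.ae_muSig] at h1 ⊢
        filter_upwards [h1, hcoe g, hcoe h, hcoe (g + h), ae_mem_Ioo] with x h1 hg hh hgh hx
        have hx' := Ioo_subset_Icc_self hx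
        rw [h1, Pi.add_apply, hg, hh, hgh, primitive_congr h2 hx']
        simp only [Pi.add_apply]
        rw [intervalIntegral.integral_add (hc.intervalIntegrable_coe g hx')
          (hc.intervalIntegrable_coe h hx'), mul_add]
      map_smul' := fun r g => by
        refine Lp.ext ?_
        have h1 := Lp.coeFn_smul r ((hmem g).toLp _)
        have h2 := hcong (Lp.coeFn_smul r g)
        rw [Filter.EventuallyEq, hc.ae_muSig] at h1 ⊢
        filter_upwards [h1, hcoe g, hcoe (r • g), ae_mem_Ioo] with x h1 hg hgh hx
        have hx' := Ioo_subset_Icc_self hx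
        rw [RingHom.id_apply, h1, Pi.smul_apply, hg, hgh, primitive_congr h2 hx']
        simp only [Pi.smul_apply, smul_eq_mul]
        rw [intervalIntegral.integral_const_mul, mul_left_comm] }
  refine ⟨T₀.mkContinuous (D ^ (1 / 2 : ℝ)).toReal fun g => ?_, hcoe⟩
  change ‖(hmem g).toLp _‖ ≤ _
  rw [Lp.norm_toLp, Lp.norm_def, ← ENNReal.toReal_mul]
  exact ENNReal.toReal_mono (ENNReal.mul_ne_top hD2 (Lp.eLpNorm_ne_top g)) (hnorm g)

lemma exists_one_div_sig_le (hc : CoeffHyp a b d K₁ K₂) :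
    ∃ C : ℝ, 0 < C ∧ ∀ x ∈ Ioo (0 : ℝ) 1, x ^ K₁ / sig a b x ≤ C := by
  obtain ⟨C, hC, h⟩ := exists_rpow_div_le hc.cont_a hc.a_pos hc.mono_a
  obtain ⟨m, M, -, hM, hM'⟩ := hc.exists_eta_bounds
  refine ⟨C * M, by positivity, fun x hx => ?_⟩
  have h1 : x ^ K₁ / sig a b x = x ^ K₁ / a x * eta a b x := by
    rw [sig]
    field_simp
  rw [h1]
  exact mul_le_mul (h x hx) (hM' x (Ioo_subset_Icc_self hx)).2 (eta_pos a b x).le hC.le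

lemma exists_primOp (hc : CoeffHyp a b d K₁ K₂) :
    ∃ S : Lp ℝ 2 (muEta a b) →L[ℝ] L2w a b, ∀ g,
      S g =ᵐ[volume.restrict (Ioo (0 : ℝ) 1)] fun x => ∫ s in (0 : ℝ)..x, g s := by
  obtain ⟨C, hC, h⟩ := hc.exists_one_div_sig_le
  have := hc.exists_weighted_primitive (w := fun _ => 1) continuousOn_const (C := C)
    fun x hx => by
      refine le_trans ?_ (h x hx)
      rw [one_pow, mul_one]
      exact div_le_div_of_nonneg_right
        (Real.rpow_le_rpow_of_exponent_ge hx.1 hx.2.le hc.K₁_mem.2.le) (hc.sig_pos hx).le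
  simpa only [one_mul] using this

lemma exists_potOp (hc : CoeffHyp a b d K₁ K₂) (hK : K₁ + 2 * K₂ ≤ 2) :
    ∃ T : Lp ℝ 2 (muEta a b) →L[ℝ] L2w a b, ∀ g,
      T g =ᵐ[volume.restrict (Ioo (0 : ℝ) 1)] fun x => (d x)⁻¹ * ∫ s in (0 : ℝ)..x, g s := by
  obtain ⟨C, hC, h⟩ := hc.exists_one_div_sig_le
  obtain ⟨C', hC', h'⟩ := exists_rpow_div_le hc.cont_d hc.d_pos hc.mono_d
  refine hc.exists_weighted_primitive (C := C * C' ^ 2)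
    ((hc.cont_d.mono Ioo_subset_Icc_self).inv₀ fun x hx =>
      (hc.d_pos x (Ioo_subset_Ioc_self hx)).ne') fun x hx => ?_
  have hd := hc.d_pos x (Ioo_subset_Ioc_self hx)
  have hs := hc.sig_pos hx
  have hx1 : 0 ≤ x ^ K₁ := Real.rpow_nonneg hx.1.le _
  have hx2 : 0 ≤ x ^ K₂ := Real.rpow_nonneg hx.1.le _
  -- this is where the assumption `K₁ + 2 K₂ ≤ 2` enters
  have h1 : x ^ (2 : ℝ) ≤ x ^ K₁ * (x ^ K₂) ^ 2 := by
    rw [← Real.rpow_natCast, ← Real.rpow_mul hx.1.le, ← Real.rpow_add hx.1]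
    refine Real.rpow_le_rpow_of_exponent_ge hx.1 hx.2.le ?_
    push_cast
    linarith
  calc x ^ (2 : ℝ) * (d x)⁻¹ ^ 2 / sig a b x
      ≤ x ^ K₁ * (x ^ K₂) ^ 2 * (d x)⁻¹ ^ 2 / sig a b x := by gcongr
    _ = x ^ K₁ / sig a b x * (x ^ K₂ / d x) ^ 2 := by
        field_simp
    _ ≤ C * C' ^ 2 := by
        gcongr
        · exact h x hx
        · exact h' x hx

/-- The operator `g ↦ ∫₀ˣ g`, which reconstructs `u ∈ H¹_{1/σ,0}` from `u'`. -/
def primOp (hc : CoeffHyp a b d K₁ K₂) : Lp ℝ 2 (muEta a b) →L[ℝ] L2w a b :=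
  hc.exists_primOp.choose

/-- The operator `g ↦ (∫₀ˣ g) / d`, which sends `u'` to `u / d`. -/
def potOp (hc : CoeffHyp a b d K₁ K₂) (hK : K₁ + 2 * K₂ ≤ 2) :
    Lp ℝ 2 (muEta a b) →L[ℝ] L2w a b :=
  (hc.exists_potOp hK).choose

lemma coeFn_primOp (hc : CoeffHyp a b d K₁ K₂) (g : Lp ℝ 2 (muEta a b)) :
    hc.primOp g =ᵐ[volume.restrict (Ioo (0 : ℝ) 1)] fun x => ∫ s in (0 : ℝ)..x, g s :=
  hc.exists_primOp.choose_spec g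

lemma coeFn_potOp (hc : CoeffHyp a b d K₁ K₂) (hK : K₁ + 2 * K₂ ≤ 2) (g : Lp ℝ 2 (muEta a b)) :
    hc.potOp hK g =ᵐ[volume.restrict (Ioo (0 : ℝ) 1)] fun x => hc.primOp g x / d x := by
  filter_upwards [(hc.exists_potOp hK).choose_spec g, hc.coeFn_primOp g] with x h1 h2
  rw [h2, div_eq_inv_mul]
  exact h1

lemma inner_L2w (hc : CoeffHyp a b d K₁ K₂) (k l : L2w a b) :
    inner ℝ k l = ∫ x in Ioo (0 : ℝ) 1, k x * l x / sig a b x := by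
  rw [L2.inner_def, hc.integral_muSig]
  simp only [RCLike.inner_apply, conj_trivial, mul_comm]

lemma integrableOn_mul_L2w (hc : CoeffHyp a b d K₁ K₂) (k l : L2w a b) :
    IntegrableOn (fun x => k x * l x / sig a b x) (Ioo (0 : ℝ) 1) := by
  have := hc.integrable_muSig.1 (L2.integrable_inner (𝕜 := ℝ) k l)
  simpa only [RCLike.inner_apply, conj_trivial, mul_comm] using this

lemma inner_muEta (hc : CoeffHyp a b d K₁ K₂) (g h : Lp ℝ 2 (muEta a b)) :
    inner ℝ g h = ∫ x in Ioo (0 : ℝ) 1, eta a b x * g x * h x := by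
  rw [L2.inner_def, hc.integral_muEta]
  simp only [RCLike.inner_apply, conj_trivial, mul_comm (h _), mul_assoc]

lemma integrableOn_mul_muEta (hc : CoeffHyp a b d K₁ K₂) (g h : Lp ℝ 2 (muEta a b)) :
    IntegrableOn (fun x => eta a b x * g x * h x) (Ioo (0 : ℝ) 1) := by
  have := hc.integrable_muEta.1 (L2.integrable_inner (𝕜 := ℝ) g h)
  simpa only [RCLike.inner_apply, conj_trivial, mul_comm (h _), mul_assoc] using this

lemma memLp_one (hc : CoeffHyp a b d K₁ K₂) : MemLp (fun _ => (1 : ℝ)) 2 (muEta a b) :=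
  hc.memLp_muEta.2 (memLp_const 1)

lemma memLp_inv_eta (hc : CoeffHyp a b d K₁ K₂) :
    MemLp (fun x => (eta a b x)⁻¹) 2 (muEta a b) := by
  obtain ⟨m, M, hm, -, h⟩ := hc.exists_eta_bounds
  refine hc.memLp_muEta.2 (MemLp.of_bound (C := m⁻¹) ?_ ?_)
  · exact ((hc.continuousOn_eta.mono Ioo_subset_Icc_self).inv₀ fun x _ =>
      (eta_pos a b x).ne').aestronglyMeasurable measurableSet_Ioo
  · filter_upwards [ae_mem_Ioo] with x hx
    rw [Real.norm_eq_abs, abs_of_pos (inv_pos.2 (eta_pos a b x))]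
    exact inv_anti₀ hm (h x (Ioo_subset_Icc_self hx)).1

/-- The functional `g ↦ ∫₀¹ g`, that is `u' ↦ u(1)`, written as the inner product of `L²(η dx)`
with `1 / η`. -/
def evOp (hc : CoeffHyp a b d K₁ K₂) : Lp ℝ 2 (muEta a b) →L[ℝ] ℝ :=
  innerSL ℝ (hc.memLp_inv_eta.toLp _)

lemma evOp_apply (hc : CoeffHyp a b d K₁ K₂) (g : Lp ℝ 2 (muEta a b)) :
    hc.evOp g = ∫ x in Ioo (0 : ℝ) 1, g x := by
  rw [evOp, innerSL_apply_apply, hc.inner_muEta]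
  have h := hc.memLp_inv_eta.coeFn_toLp
  rw [Filter.EventuallyEq, hc.ae_muEta] at h
  refine integral_congr_ae ?_
  filter_upwards [h] with x hx
  rw [hx, mul_inv_cancel₀ (eta_pos a b x).ne', one_mul]

lemma coeFn_toLp_muEta (hc : CoeffHyp a b d K₁ K₂) {f : ℝ → ℝ} (hf : MemLp f 2 (muEta a b)) :
    (hf.toLp f : ℝ → ℝ) =ᵐ[volume.restrict (Ioo (0 : ℝ) 1)] f := by
  have h := hf.coeFn_toLp
  rwa [Filter.EventuallyEq, hc.ae_muEta] at h

lemma integrableOn_mul_div_sig (hc : CoeffHyp a b d K₁ K₂) (k : L2w a b) :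
    IntegrableOn (fun x => x * (k x / sig a b x)) (Ioo (0 : ℝ) 1) := by
  refine (hc.integrableOn_mul_L2w k (hc.primOp (hc.memLp_one.toLp _))).congr_fun_ae ?_
  filter_upwards [hc.coeFn_primOp (hc.memLp_one.toLp _), ae_mem_Ioo] with x hx hxm
  rw [hx, primitive_congr (hc.coeFn_toLp_muEta hc.memLp_one) (Ioo_subset_Icc_self hxm)]
  simp only [intervalIntegral.integral_const, sub_zero, smul_eq_mul, mul_one]
  ring

lemma integrableOn_div_sig (hc : CoeffHyp a b d K₁ K₂) (k : L2w a b) {c : ℝ} (h0 : 0 < c) :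
    IntegrableOn (fun x => k x / sig a b x) (Ioo c 1) := by
  have h1 : IntegrableOn (fun x => x⁻¹ * (x * (k x / sig a b x))) (Ioo c 1) := by
    refine Integrable.bdd_mul (c := c⁻¹) ((hc.integrableOn_mul_div_sig k).mono_set
      (Ioo_subset_Ioo_left h0.le)) measurable_inv.aestronglyMeasurable ?_
    filter_upwards [ae_restrict_mem measurableSet_Ioo] with x hx
    rw [Real.norm_eq_abs, abs_of_pos (inv_pos.2 (h0.trans hx.1))]
    exact inv_anti₀ h0 hx.1.le
  refine h1.congr_fun (fun x hx => ?_) measurableSet_Ioo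
  exact inv_mul_cancel_left₀ (h0.trans hx.1).ne' _

lemma locallyIntegrableOn_div_sig (hc : CoeffHyp a b d K₁ K₂) (k : L2w a b) :
    LocallyIntegrableOn (fun x => k x / sig a b x) (Ioo (0 : ℝ) 1) := fun x hx =>
  ⟨Ioo (x / 2) 1, mem_nhdsWithin_of_mem_nhds
    (Ioo_mem_nhds (by linarith [hx.1]) hx.2), hc.integrableOn_div_sig k (half_pos hx.1)⟩

lemma continuousOn_tail (hc : CoeffHyp a b d K₁ K₂) (k : L2w a b) :
    ContinuousOn (fun s => ∫ x in s..1, k x / sig a b x) (Ioc 0 1) := by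
  intro s hs
  have h0 : 0 < s / 2 := half_pos hs.1
  have hle : s / 2 ≤ 1 := by linarith [hs.2]
  have h1 : IntervalIntegrable (fun x => k x / sig a b x) volume (s / 2) 1 := by
    rw [intervalIntegrable_iff_integrableOn_Ioo_of_le hle]
    exact hc.integrableOn_div_sig k h0
  have h2 := intervalIntegral.continuousOn_primitive_interval' h1 right_mem_uIcc
  rw [uIcc_of_le hle] at h2
  have h3 : ContinuousWithinAt (fun s => ∫ x in s..1, k x / sig a b x) (Icc (s / 2) 1) s := by
    simp_rw [intervalIntegral.integral_symm (1 : ℝ)]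
    exact (h2 s ⟨by linarith [hs.1], hs.2⟩).neg
  refine h3.mono_of_mem_nhdsWithin ?_
  filter_upwards [self_mem_nhdsWithin, mem_nhdsWithin_of_mem_nhds
    (Ioi_mem_nhds (show s / 2 < s by linarith [hs.1]))] with y hy hy'
  exact ⟨le_of_lt hy', hy.2⟩

/-- With respect to the pairings `∫ · · / σ` and `∫ · ·`, the adjoint of `g ↦ ∫₀ˣ g` is
`k ↦ ∫ₛ¹ k / σ`. -/
lemma inner_primOp (hc : CoeffHyp a b d K₁ K₂) (k : L2w a b) (h : Lp ℝ 2 (muEta a b)) :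
    IntegrableOn (fun s => h s * ∫ x in s..1, k x / sig a b x) (Ioo (0 : ℝ) 1) ∧
      inner ℝ k (hc.primOp h) =
        ∫ s in Ioo (0 : ℝ) 1, h s * ∫ x in s..1, k x / sig a b x := by
  have habs := Lp.coeFn_abs h
  rw [Filter.EventuallyEq, hc.ae_muEta] at habs
  have key := fubini_triangle (G := fun x => k x / sig a b x) (h := h)
    (hc.locallyIntegrableOn_div_sig k).aestronglyMeasurable (hc.integrableOn_coe h) (by
      refine (hc.integrableOn_mul_L2w k (hc.primOp |h|)).congr_fun_ae ?_
      filter_upwards [hc.coeFn_primOp |h|, ae_mem_Ioo] with x hx hxm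
      rw [hx, primitive_congr habs (Ioo_subset_Icc_self hxm)]
      ring)
  refine ⟨key.1, ?_⟩
  rw [← key.2, hc.inner_L2w]
  refine integral_congr_ae ?_
  filter_upwards [hc.coeFn_primOp h] with x hx
  rw [hx]
  ring

end CoeffHyp

/-! ### The space `H¹_{1/σ,0}` and the operator `A` in terms of `u'` -/

lemma IsWeakDeriv.add_const {f g : ℝ → ℝ} (h : IsWeakDeriv f g) (c : ℝ) :
    IsWeakDeriv (fun x => f x + c) g := by
  have hcl : LocallyIntegrableOn (fun _ : ℝ => c) (Ioo (0 : ℝ) 1) :=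
    continuous_const.locallyIntegrable.locallyIntegrableOn _
  refine ⟨h.1.add hcl, h.2.1, fun φ hφ hφc hφs => ?_⟩
  have hd : Continuous (deriv φ) := hφ.continuous_deriv (by simp)
  have hds := (tsupport_deriv_sub φ).trans hφs
  have h0 : ∫ x in Ioo (0 : ℝ) 1, deriv φ x = 0 := by
    rw [← integral_Ioc_eq_integral_Ioo, ← intervalIntegral.integral_of_le zero_le_one,
      integral_deriv_test hφ, eq_zero_of_tsupport_subset hφs (x := 1) (by simp),
      eq_zero_of_tsupport_subset hφs (x := 0) (by simp), sub_zero]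
  simp only [add_mul]
  rw [integral_add (integrable_mul_of_compactSupport h.1 hd hφc.deriv hds)
    (integrable_mul_of_compactSupport hcl hd hφc.deriv hds), integral_const_mul, h0, mul_zero,
    add_zero, h.2.2 φ hφ hφc hφs]

lemma IsWeakDeriv.congr_right {f g g' : ℝ → ℝ} (h : IsWeakDeriv f g)
    (hgg : g =ᵐ[volume.restrict (Ioo (0 : ℝ) 1)] g')
    (hg' : LocallyIntegrableOn g' (Ioo (0 : ℝ) 1)) : IsWeakDeriv f g' := by
  refine ⟨h.1, hg', fun φ hφ hφc hφs => ?_⟩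
  rw [h.2.2 φ hφ hφc hφs]
  congr 1
  refine integral_congr_ae ?_
  filter_upwards [hgg] with x hx
  rw [hx]

namespace CoeffHyp

lemma memLp_test (hc : CoeffHyp a b d K₁ K₂) {φ : ℝ → ℝ} (hφ : Continuous φ)
    (hs : HasCompactSupport φ) : MemLp φ 2 (muEta a b) :=
  hc.memLp_muEta.2 ((hφ.memLp_of_hasCompactSupport hs).restrict _)

lemma toL2_eq (hc : CoeffHyp a b d K₁ K₂) (u : H10 a b) : toL2 u = hc.primOp (der u) := by
  obtain ⟨f, g, hf, hg, hw, hfc, h0⟩ := u.2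
  change toL2 u =ᵐ[muSig a b] f at hf
  change der u =ᵐ[muEta a b] g at hg
  refine Lp.ext ?_
  rw [Filter.EventuallyEq, hc.ae_muSig] at hf ⊢
  rw [Filter.EventuallyEq, hc.ae_muEta] at hg
  have hgi : IntegrableOn g (Ioo (0 : ℝ) 1) := (hc.integrableOn_coe (der u)).congr_fun_ae hg
  filter_upwards [hf, hw.ae_eq_primitive hgi hfc h0, hc.coeFn_primOp (der u), ae_mem_Ioo]
    with x h1 h2 h3 hx
  rw [h1, h2, h3, primitive_congr hg (Ioo_subset_Icc_self hx)]

lemma mem_H10_iff (hc : CoeffHyp a b d K₁ K₂)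
    (p : WithLp 2 (L2w a b × Lp ℝ 2 (muEta a b))) :
    p ∈ H10 a b ↔ p.fst = hc.primOp p.snd := by
  refine ⟨fun hp => hc.toL2_eq ⟨p, hp⟩, fun hp => ?_⟩
  refine ⟨fun x => ∫ s in (0 : ℝ)..x, p.snd s, p.snd, ?_, Filter.EventuallyEq.rfl,
    isWeakDeriv_primitive (hc.integrableOn_coe _), continuousOn_primitive (hc.integrableOn_coe _),
    by simp⟩
  rw [hp, Filter.EventuallyEq, hc.ae_muSig]
  exact hc.coeFn_primOp _

/-- The element of `H¹_{1/σ,0}` with derivative `g`. -/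
def ofDer (hc : CoeffHyp a b d K₁ K₂) (g : Lp ℝ 2 (muEta a b)) : H10 a b :=
  ⟨WithLp.toLp 2 (hc.primOp g, g), (hc.mem_H10_iff _).2 rfl⟩

@[simp] lemma der_ofDer (hc : CoeffHyp a b d K₁ K₂) (g : Lp ℝ 2 (muEta a b)) :
    der (hc.ofDer g) = g := rfl

lemma H10_ext (hc : CoeffHyp a b d K₁ K₂) {u v : H10 a b} (h : der u = der v) : u = v := by
  refine Subtype.ext ((WithLp.ofLp_injective 2) (Prod.ext ?_ h))
  change toL2 u = toL2 v
  rw [hc.toL2_eq, hc.toL2_eq, h]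

lemma toL2_injective (hc : CoeffHyp a b d K₁ K₂) : Function.Injective (toL2 (a := a) (b := b)) := by
  intro u v huv
  obtain ⟨f, g, hf, hg, hw, -⟩ := u.2
  obtain ⟨f', g', hf', hg', hw', -⟩ := v.2
  change toL2 u =ᵐ[muSig a b] f at hf
  change toL2 v =ᵐ[muSig a b] f' at hf'
  change der u =ᵐ[muEta a b] g at hg
  change der v =ᵐ[muEta a b] g' at hg'
  have h1 : f =ᵐ[volume.restrict (Ioo (0 : ℝ) 1)] f' := by
    have := (hf.symm.trans (by rw [huv])).trans hf'
    rwa [Filter.EventuallyEq, hc.ae_muSig] at this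
  have h2 := (hw.congr_left h1 hw'.1).unique hw'
  refine hc.H10_ext (Lp.ext ((hg.trans ?_).trans hg'.symm))
  rwa [Filter.EventuallyEq, hc.ae_muEta]

lemma completeSpace_H10 (hc : CoeffHyp a b d K₁ K₂) : CompleteSpace (H10 a b) := by
  have h : IsClosed (H10 a b : Set (WithLp 2 (L2w a b × Lp ℝ 2 (muEta a b)))) := by
    have : (H10 a b : Set (WithLp 2 (L2w a b × Lp ℝ 2 (muEta a b)))) =
        {p | WithLp.fstL 2 ℝ _ _ p = hc.primOp (WithLp.sndL 2 ℝ _ _ p)} := by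
      ext p
      exact hc.mem_H10_iff p
    rw [this]
    exact isClosed_eq (by fun_prop) (by fun_prop)
  exact h.completeSpace_coe

lemma hasValueAt_toL2 (hc : CoeffHyp a b d K₁ K₂) (u : H10 a b) :
    HasValueAt (toL2 u) 1 (hc.evOp (der u)) := by
  refine ⟨fun x => ∫ s in (0 : ℝ)..x, der u s, ?_, ?_, ?_⟩
  · refine (continuousOn_primitive (hc.integrableOn_coe (der u))).mono ?_
    exact insert_subset (by simp) Ioo_subset_Icc_self
  · rw [hc.toL2_eq]
    exact hc.coeFn_primOp _
  · change ∫ s in (0 : ℝ)..1, der u s = _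
    rw [hc.evOp_apply, intervalIntegral.integral_of_le zero_le_one, integral_Ioc_eq_integral_Ioo]

lemma locallyIntegrableOn_eta_mul (hc : CoeffHyp a b d K₁ K₂) (g : Lp ℝ 2 (muEta a b)) :
    LocallyIntegrableOn (fun x => eta a b x * g x) (Ioo (0 : ℝ) 1) :=
  (hc.integrableOn_coe g).locallyIntegrableOn.continuousOn_mul
    (hc.continuousOn_eta.mono Ioo_subset_Icc_self) isOpen_Ioo.isLocallyClosed

lemma locallyIntegrableOn_tail (hc : CoeffHyp a b d K₁ K₂) (k : L2w a b) :
    LocallyIntegrableOn (fun s => ∫ x in s..1, k x / sig a b x) (Ioo (0 : ℝ) 1) :=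
  ((hc.continuousOn_tail k).mono Ioo_subset_Ioc_self).locallyIntegrableOn measurableSet_Ioo

lemma isWeakDeriv_tail (hc : CoeffHyp a b d K₁ K₂) (k : L2w a b) :
    IsWeakDeriv (fun s => -∫ x in s..1, k x / sig a b x) (fun x => k x / sig a b x) := by
  refine ⟨(hc.locallyIntegrableOn_tail k).neg, hc.locallyIntegrableOn_div_sig k,
    fun φ hφ hφc hφs => ?_⟩
  have hd : Continuous (deriv φ) := hφ.continuous_deriv (by simp)
  have hmem := hc.memLp_test hd hφc.deriv
  have h1 := (hc.inner_primOp k (hmem.toLp _)).2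
  have h2 := hc.coeFn_toLp_muEta hmem
  have h3 : inner ℝ k (hc.primOp (hmem.toLp _)) =
      ∫ x in Ioo (0 : ℝ) 1, k x / sig a b x * φ x := by
    rw [hc.inner_L2w]
    refine integral_congr_ae ?_
    filter_upwards [hc.coeFn_primOp (hmem.toLp _), ae_mem_Ioo] with x hx hxm
    rw [hx, primitive_congr h2 (Ioo_subset_Icc_self hxm), integral_deriv_test hφ,
      eq_zero_of_tsupport_subset hφs (x := 0) (by simp), sub_zero]
    ring
  rw [← h3, h1, ← integral_neg]
  refine integral_congr_ae ?_
  filter_upwards [h2] with x hx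
  rw [hx]
  ring

/-- The weak form of `σ (η g)' = k`, `η(1) g(1) = p`, integrated once. -/
lemma weakForm_iff_ae (hc : CoeffHyp a b d K₁ K₂) (g : Lp ℝ 2 (muEta a b)) (k : L2w a b) (p : ℝ) :
    (∀ h : Lp ℝ 2 (muEta a b), inner ℝ g h + inner ℝ k (hc.primOp h) = p * hc.evOp h) ↔
      ∀ᵐ s ∂(volume.restrict (Ioo (0 : ℝ) 1)),
        eta a b s * g s + ∫ x in s..1, k x / sig a b x = p := by
  have hint : ∀ h : Lp ℝ 2 (muEta a b), inner ℝ g h + inner ℝ k (hc.primOp h) - p * hc.evOp h =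
      ∫ s in Ioo (0 : ℝ) 1, h s * (eta a b s * g s + (∫ x in s..1, k x / sig a b x) - p) := by
    intro h
    have hI : IntegrableOn (fun s => eta a b s * g s * h s + h s * ∫ x in s..1, k x / sig a b x)
        (Ioo (0 : ℝ) 1) := (hc.integrableOn_mul_muEta g h).add (hc.inner_primOp k h).1
    rw [hc.inner_muEta, (hc.inner_primOp k h).2, hc.evOp_apply, ← integral_const_mul,
      ← integral_add (hc.integrableOn_mul_muEta g h) (hc.inner_primOp k h).1,
      ← integral_sub hI ((hc.integrableOn_coe h).const_mul p)]
    congr 1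
    ext s
    ring
  constructor
  · intro H
    have hloc : LocallyIntegrableOn
        (fun s => eta a b s * g s + (∫ x in s..1, k x / sig a b x) - p) (Ioo (0 : ℝ) 1) :=
      ((hc.locallyIntegrableOn_eta_mul g).add (hc.locallyIntegrableOn_tail k)).sub
        (continuous_const.locallyIntegrable.locallyIntegrableOn _)
    have key := isOpen_Ioo.ae_eq_zero_of_integral_contDiff_smul_eq_zero hloc
      fun φ hφ hφc hφs => by
        have hmem := hc.memLp_test hφ.continuous hφc
        have h1 := hint (hmem.toLp _)
        rw [H, sub_self] at h1
        simp only [smul_eq_mul, mul_comm (φ _)]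
        refine (setIntegral_Ioo_eq_integral hφs _).symm.trans (Eq.trans ?_ h1.symm)
        refine integral_congr_ae ?_
        filter_upwards [hc.coeFn_toLp_muEta hmem] with x hx
        rw [hx, mul_comm]
    rw [ae_restrict_iff' measurableSet_Ioo]
    filter_upwards [key] with x hx hxm
    exact sub_eq_zero.1 (hx hxm)
  · intro H h
    rw [← sub_eq_zero, hint]
    refine integral_eq_zero_of_ae ?_
    filter_upwards [H] with s hs
    rw [hs, sub_self, mul_zero, Pi.zero_apply]

lemma hasValueAt_one (hc : CoeffHyp a b d K₁ K₂) {g : Lp ℝ 2 (muEta a b)} {k : L2w a b} {p : ℝ}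
    (h : ∀ᵐ s ∂(volume.restrict (Ioo (0 : ℝ) 1)),
      eta a b s * g s + ∫ x in s..1, k x / sig a b x = p) :
    HasValueAt g 1 (p / eta a b 1) := by
  refine ⟨fun s => (p - ∫ x in s..1, k x / sig a b x) / eta a b s, ?_, ?_, ?_⟩
  · rw [Ioo_insert_right zero_lt_one]
    exact (continuousOn_const.sub (hc.continuousOn_tail k)).div
      (hc.continuousOn_eta.mono Ioc_subset_Icc_self) fun x _ => (eta_pos a b x).ne'
  · filter_upwards [h] with s hs
    rw [← hs, add_sub_cancel_right, mul_div_cancel_left₀ _ (eta_pos a b s).ne']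
  · simp

/-- Green's formula: the weak form encodes `σ (η g)' = k` together with the boundary value
`η(1) g(1) = p`, and no condition at the degenerate endpoint. -/
lemma weakForm_iff (hc : CoeffHyp a b d K₁ K₂) (g : Lp ℝ 2 (muEta a b)) (k : L2w a b) (p : ℝ) :
    (∀ h : Lp ℝ 2 (muEta a b), inner ℝ g h + inner ℝ k (hc.primOp h) = p * hc.evOp h) ↔
      IsWeakDeriv (fun x => eta a b x * g x) (fun x => k x / sig a b x) ∧
        HasValueAt g 1 (p / eta a b 1) := by
  rw [hc.weakForm_iff_ae]
  constructor
  · intro h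
    refine ⟨?_, hc.hasValueAt_one h⟩
    refine ((hc.isWeakDeriv_tail k).add_const p).congr_left ?_ (hc.locallyIntegrableOn_eta_mul g)
    filter_upwards [h] with s hs
    rw [← hs]
    ring
  · rintro ⟨hw, hv⟩
    obtain ⟨c, hcc⟩ := hw.sub_ae_eq_const (hc.isWeakDeriv_tail k)
    have h1 : ∀ᵐ s ∂(volume.restrict (Ioo (0 : ℝ) 1)),
        eta a b s * g s + ∫ x in s..1, k x / sig a b x = c := by
      filter_upwards [hcc] with s hs
      rw [hs]
      ring
    have h2 := (hc.hasValueAt_one h1).unique hv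
    rw [div_left_inj' (eta_pos a b 1).ne'] at h2
    rwa [h2] at h1

lemma mem_H2_iff (hc : CoeffHyp a b d K₁ K₂) (u : H10 a b) (k : L2w a b) :
    WithLp.toLp 2 (u, k) ∈ H2 a b ↔
      IsWeakDeriv (fun x => eta a b x * der u x) (fun x => k x / sig a b x) := by
  constructor
  · rintro ⟨g, G, hg, hw, hG⟩
    change der u =ᵐ[muEta a b] g at hg
    change k =ᵐ[muSig a b] _ at hG
    rw [Filter.EventuallyEq, hc.ae_muEta] at hg
    rw [Filter.EventuallyEq, hc.ae_muSig] at hG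
    refine (hw.congr_left ?_ (hc.locallyIntegrableOn_eta_mul _)).congr_right ?_
      (hc.locallyIntegrableOn_div_sig k)
    · filter_upwards [hg] with x hx
      rw [hx]
    · filter_upwards [hG, ae_mem_Ioo] with x hx hxm
      rw [hx, mul_div_cancel_left₀ _ (hc.sig_pos hxm).ne']
  · intro h
    refine ⟨der u, fun x => k x / sig a b x, Filter.EventuallyEq.rfl, h, ?_⟩
    change k =ᵐ[muSig a b] _
    rw [Filter.EventuallyEq, hc.ae_muSig]
    filter_upwards [ae_mem_Ioo] with x hxm
    rw [mul_div_cancel₀ _ (hc.sig_pos hxm).ne']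

lemma mem_DAlam_iff (hc : CoeffHyp a b d K₁ K₂) (hK : K₁ + 2 * K₂ ≤ 2) {lam : ℝ} (w : H2 a b)
    (l : L2w a b) : WithLp.toLp 2 (w, l) ∈ DAlam a b d lam ↔
      l = opA w + lam • hc.potOp hK (der (toH10 w)) := by
  have h1 := Lp.coeFn_add (opA w) (lam • hc.potOp hK (der (toH10 w)))
  have h2 := Lp.coeFn_smul lam (hc.potOp hK (der (toH10 w)))
  have h3 := hc.coeFn_potOp hK (der (toH10 w))
  rw [Filter.EventuallyEq, hc.ae_muSig] at h1 h2
  have key : (opA w + lam • hc.potOp hK (der (toH10 w)) : L2w a b) =ᵐ[muSig a b]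
      fun x => opA w x + lam * (toL2 (toH10 w) x / d x) := by
    rw [Filter.EventuallyEq, hc.ae_muSig]
    filter_upwards [h1, h2, h3] with x h1 h2 h3
    rw [h1, Pi.add_apply, h2, Pi.smul_apply, h3, hc.toL2_eq, smul_eq_mul]
  change l =ᵐ[muSig a b] (fun x => opA w x + lam * (toL2 (toH10 w) x / d x)) ↔ _
  exact ⟨fun h => Lp.ext (h.trans key.symm), fun h => by rw [h]; exact key⟩

lemma opA_eq (hc : CoeffHyp a b d K₁ K₂) (hK : K₁ + 2 * K₂ ≤ 2) {lam : ℝ}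
    (w : DAlam a b d lam) :
    opA w.1.fst = opAlam w - lam • hc.potOp hK (der (domToH10 w)) :=
  eq_sub_of_add_eq ((hc.mem_DAlam_iff hK w.1.fst w.1.snd).1 w.2).symm

lemma exists_DAlam_iff (hc : CoeffHyp a b d K₁ K₂) (hK : K₁ + 2 * K₂ ≤ 2) {lam : ℝ} (u : H10 a b)
    (l : L2w a b) : (∃ w : DAlam a b d lam, domToH10 w = u ∧ opAlam w = l) ↔
      WithLp.toLp 2 (u, l - lam • hc.potOp hK (der u)) ∈ H2 a b := by
  constructor
  · rintro ⟨w, rfl, rfl⟩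
    rw [← hc.opA_eq hK]
    exact w.1.fst.2
  · intro h
    exact ⟨⟨WithLp.toLp 2 (⟨_, h⟩, l), (hc.mem_DAlam_iff hK _ _).2 (sub_add_cancel _ _).symm⟩,
      rfl, rfl⟩

/-- The generator in weak form.  The boundary condition is the natural one. -/
lemma gen_iff (hc : CoeffHyp a b d K₁ K₂) (hK : K₁ + 2 * K₂ ≤ 2) {lam beta : ℝ} (U F : H0 a b) :
    Gen a b d lam beta U F ↔ U.snd = hc.primOp (der F.fst) ∧ ∀ h : Lp ℝ 2 (muEta a b),
      inner ℝ (der U.fst) h - lam * inner ℝ (hc.potOp hK (der U.fst)) (hc.primOp h) +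
        inner ℝ F.snd (hc.primOp h) +
        (hc.evOp (der F.fst) + beta * hc.evOp (der U.fst)) * hc.evOp h = 0 := by
  have hη := (eta_pos a b 1).ne'
  rw [Gen, hc.exists_DAlam_iff hK, hc.mem_H2_iff, hc.toL2_eq, eq_comm (a := U.snd)]
  have hB : BoundaryCond beta U.fst F.fst ↔ HasValueAt (der U.fst) 1
      (-(hc.evOp (der F.fst) + beta * hc.evOp (der U.fst)) / eta a b 1) := by
    constructor
    · rintro ⟨p, q, r, hp, hq, hr, h0⟩
      rw [(hc.hasValueAt_toL2 F.fst).unique hp, (hc.hasValueAt_toL2 U.fst).unique hr]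
      convert hq using 1
      rw [div_eq_iff hη]
      linarith
    · intro h
      refine ⟨_, _, _, hc.hasValueAt_toL2 F.fst, h, hc.hasValueAt_toL2 U.fst, ?_⟩
      rw [mul_div_cancel₀ _ hη]
      ring
  rw [hB, and_left_comm, ← hc.weakForm_iff]
  refine and_congr_right fun _ => forall_congr' fun h => ?_
  rw [inner_sub_left, real_inner_smul_left]
  constructor <;> intro h <;> linarith

end CoeffHyp

/-! ### The energy form and the generator of the wave equation -/

/-- The inner product of a real inner product space as a bounded bilinear form. -/
def innerForm (E : Type*) [NormedAddCommGroup E] [InnerProductSpace ℝ E] : E →L[ℝ] E →L[ℝ] ℝ :=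
  (isBoundedBilinearMap_inner (𝕜 := ℝ) (E := E)).toContinuousLinearMap

@[simp] lemma innerForm_apply {E : Type*} [NormedAddCommGroup E] [InnerProductSpace ℝ E]
    (x y : E) : innerForm E x y = inner ℝ x y := rfl

/-- The map `u ↦ u'` as a bounded operator. -/
def derL (a b : ℝ → ℝ) : H10 a b →L[ℝ] Lp ℝ 2 (muEta a b) :=
  WithLp.sndL 2 ℝ (L2w a b) (Lp ℝ 2 (muEta a b)) ∘L (H10 a b).subtypeL

/-- The inclusion `H¹_{1/σ,0} ⊆ L²_{1/σ}` as a bounded operator. -/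
def toL2L (a b : ℝ → ℝ) : H10 a b →L[ℝ] L2w a b :=
  WithLp.fstL 2 ℝ (L2w a b) (Lp ℝ 2 (muEta a b)) ∘L (H10 a b).subtypeL

/-- The map `(u, v) ↦ u'` on the energy space. -/
def fstDer (a b : ℝ → ℝ) : H0 a b →L[ℝ] Lp ℝ 2 (muEta a b) :=
  derL a b ∘L WithLp.fstL 2 ℝ (H10 a b) (L2w a b)

namespace CoeffHyp

/-- The quadratic form `⟨g, h⟩ - λ ∫ u w / (σ d) + β u(1) w(1)` with `u' = g`, `w' = h`. -/
def potForm (hc : CoeffHyp a b d K₁ K₂) (hK : K₁ + 2 * K₂ ≤ 2) (lam beta : ℝ) :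
    Lp ℝ 2 (muEta a b) →L[ℝ] Lp ℝ 2 (muEta a b) →L[ℝ] ℝ :=
  innerForm _ - lam • (innerForm _).bilinearComp (hc.potOp hK) hc.primOp +
    beta • (innerForm ℝ).bilinearComp hc.evOp hc.evOp

lemma potForm_apply (hc : CoeffHyp a b d K₁ K₂) (hK : K₁ + 2 * K₂ ≤ 2) (lam beta : ℝ)
    (g h : Lp ℝ 2 (muEta a b)) : hc.potForm hK lam beta g h =
      inner ℝ g h - lam * inner ℝ (hc.potOp hK g) (hc.primOp h) +
        beta * (hc.evOp g * hc.evOp h) := by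
  simp [potForm, mul_comm (hc.evOp h)]

/-- The energy form `∫ η u' w' + ∫ v z / σ - λ ∫ u w / (σ d) + β u(1) w(1)` of `(u, v)` and
`(w, z)`. -/
def energy (hc : CoeffHyp a b d K₁ K₂) (hK : K₁ + 2 * K₂ ≤ 2) (lam beta : ℝ) :
    H0 a b →L[ℝ] H0 a b →L[ℝ] ℝ :=
  (hc.potForm hK lam beta).bilinearComp (fstDer a b) (fstDer a b) +
    (innerForm _).bilinearComp (WithLp.sndL 2 ℝ (H10 a b) (L2w a b))
      (WithLp.sndL 2 ℝ (H10 a b) (L2w a b))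

lemma energy_apply (hc : CoeffHyp a b d K₁ K₂) (hK : K₁ + 2 * K₂ ≤ 2) (lam beta : ℝ)
    (U V : H0 a b) : hc.energy hK lam beta U V =
      hc.potForm hK lam beta (der U.fst) (der V.fst) + inner ℝ U.snd V.snd := rfl

/-- The graph of the generator, in weak form. -/
def genGraph (hc : CoeffHyp a b d K₁ K₂) (hK : K₁ + 2 * K₂ ≤ 2) (lam beta : ℝ) :
    Submodule ℝ (H0 a b × H0 a b) where
  carrier := {p | p.1.snd = hc.primOp (fstDer a b p.2) ∧ ∀ h : Lp ℝ 2 (muEta a b),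
    hc.potForm hK lam beta (fstDer a b p.1) h + inner ℝ p.2.snd (hc.primOp h) +
      hc.evOp (fstDer a b p.2) * hc.evOp h = 0}
  add_mem' := by
    rintro p q ⟨h1, h2⟩ ⟨h3, h4⟩
    refine ⟨?_, fun h => ?_⟩
    · rw [Prod.fst_add, Prod.snd_add, WithLp.add_snd, map_add, map_add, h1, h3]
    · rw [Prod.fst_add, Prod.snd_add, WithLp.add_snd, map_add, map_add, map_add, map_add,
        add_apply, inner_add_left]
      linarith [h2 h, h4 h]
  zero_mem' := by
    refine ⟨?_, fun h => ?_⟩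
    · simp
    · simp
  smul_mem' := by
    rintro c p ⟨h1, h2⟩
    refine ⟨?_, fun h => ?_⟩
    · rw [Prod.smul_fst, Prod.smul_snd, WithLp.smul_snd, map_smul, map_smul, h1]
    · rw [Prod.smul_fst, Prod.smul_snd, WithLp.smul_snd, map_smul, map_smul, map_smul, map_smul,
        smul_apply, real_inner_smul_left, smul_eq_mul, smul_eq_mul]
      linear_combination c * h2 h

lemma mem_genGraph (hc : CoeffHyp a b d K₁ K₂) (hK : K₁ + 2 * K₂ ≤ 2) {lam beta : ℝ}
    (U F : H0 a b) : (U, F) ∈ hc.genGraph hK lam beta ↔ Gen a b d lam beta U F := by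
  rw [hc.gen_iff hK]
  refine and_congr Iff.rfl (forall_congr' fun h => ?_)
  change hc.potForm hK lam beta (der U.fst) h + inner ℝ F.snd (hc.primOp h) +
      hc.evOp (der F.fst) * hc.evOp h = 0 ↔ _
  rw [hc.potForm_apply]
  constructor <;> intro h <;> linarith

lemma inner_potOp (hc : CoeffHyp a b d K₁ K₂) (hK : K₁ + 2 * K₂ ≤ 2) (g h : Lp ℝ 2 (muEta a b)) :
    inner ℝ (hc.potOp hK g) (hc.primOp h) =
      ∫ x in Ioo (0 : ℝ) 1, hc.primOp g x * hc.primOp h x / (sig a b x * d x) := by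
  rw [hc.inner_L2w]
  refine integral_congr_ae ?_
  filter_upwards [hc.coeFn_potOp hK g] with x hx
  rw [hx]
  ring

/-- Below the Hardy–Poincaré threshold the potential is dominated by the Dirichlet form. -/
lemma exists_potForm_ge (hc : CoeffHyp a b d K₁ K₂) (hK : K₁ + 2 * K₂ ≤ 2) {lam beta : ℝ}
    (hlam : lam < 1 / CHP a b d) (hbeta : 0 ≤ beta) :
    ∃ c : ℝ, 0 < c ∧ ∀ g : Lp ℝ 2 (muEta a b), c * ‖g‖ ^ 2 ≤ hc.potForm hK lam beta g g := by
  have hbe : ∀ g, 0 ≤ beta * (hc.evOp g * hc.evOp g) := fun g =>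
    mul_nonneg hbeta (mul_self_nonneg _)
  have hpos : ∀ g, 0 ≤ inner ℝ (hc.potOp hK g) (hc.primOp g) := by
    intro g
    rw [hc.inner_potOp hK]
    refine setIntegral_nonneg measurableSet_Ioo fun x hx => ?_
    exact div_nonneg (mul_self_nonneg _)
      (mul_pos (hc.sig_pos hx) (hc.d_pos x (Ioo_subset_Ioc_self hx))).le
  rcases le_or_gt lam 0 with h0 | h0
  · refine ⟨1, one_pos, fun g => ?_⟩
    rw [hc.potForm_apply, real_inner_self_eq_norm_sq]
    nlinarith [hbe g, mul_nonneg (neg_nonneg.2 h0) (hpos g)]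
  · have hC0 : 0 < CHP a b d := one_div_pos.1 (h0.trans hlam)
    have hlt : CHP a b d < 1 / lam := by
      rwa [lt_one_div hC0 h0]
    rw [CHP] at hlt hC0
    obtain ⟨C, ⟨hC, hCu⟩, hClt⟩ := exists_lt_of_csInf_lt (by
      by_contra hne
      rw [not_nonempty_iff_eq_empty.1 hne, Real.sInf_empty] at hC0
      exact lt_irrefl _ hC0) hlt
    have h1 : lam * C < 1 := by
      rwa [lt_div_iff₀ h0, mul_comm] at hClt
    refine ⟨1 - lam * C, by linarith, fun g => ?_⟩
    have h2 := (hCu (hc.ofDer g)).2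
    rw [hc.toL2_eq, hc.der_ofDer] at h2
    have h3 : inner ℝ (hc.potOp hK g) (hc.primOp g) ≤ C * ‖g‖ ^ 2 := by
      rw [hc.inner_potOp hK, ← real_inner_self_eq_norm_sq, hc.inner_muEta]
      simpa only [pow_two, mul_assoc] using h2
    rw [hc.potForm_apply, real_inner_self_eq_norm_sq]
    nlinarith [hbe g, mul_le_mul_of_nonneg_left h3 h0.le]

lemma energy_coercive (hc : CoeffHyp a b d K₁ K₂) (hK : K₁ + 2 * K₂ ≤ 2) {lam beta : ℝ}
    (hlam : lam < 1 / CHP a b d) (hbeta : 0 ≤ beta) : IsCoercive (hc.energy hK lam beta) := by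
  obtain ⟨c, hcpos, h⟩ := hc.exists_potForm_ge hK hlam hbeta
  set N := 1 + ‖hc.primOp‖ ^ 2
  have hN : 0 < N := by positivity
  refine ⟨min (c / N) 1, by positivity, fun U => ?_⟩
  have h1 : ‖U.fst‖ ^ 2 ≤ N * ‖der U.fst‖ ^ 2 := by
    have h2 : ‖U.fst‖ ^ 2 = ‖toL2 U.fst‖ ^ 2 + ‖der U.fst‖ ^ 2 :=
      WithLp.prod_norm_sq_eq_of_L2 U.fst.1
    have h3 : ‖toL2 U.fst‖ ≤ ‖hc.primOp‖ * ‖der U.fst‖ := by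
      rw [hc.toL2_eq]
      exact hc.primOp.le_opNorm _
    have h4 := pow_le_pow_left₀ (norm_nonneg _) h3 2
    rw [mul_pow] at h4
    simp only [N]
    linarith
  rw [hc.energy_apply, real_inner_self_eq_norm_sq, mul_assoc, ← pow_two,
    WithLp.prod_norm_sq_eq_of_L2, mul_add]
  refine add_le_add (le_trans ?_ (h _)) ?_
  · calc min (c / N) 1 * ‖U.fst‖ ^ 2 ≤ c / N * (N * ‖der U.fst‖ ^ 2) := by
          gcongr
          exact min_le_left _ _
      _ = c * ‖der U.fst‖ ^ 2 := by field_simp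
  · exact mul_le_of_le_one_left (by positivity) (min_le_right _ _)

/-- The equation `U - h 𝓐 U = (f, z)` reduces to a coercive variational problem for `u'`. -/
lemma genGraph_range (hc : CoeffHyp a b d K₁ K₂) (hK : K₁ + 2 * K₂ ≤ 2) {lam beta : ℝ}
    (hlam : lam < 1 / CHP a b d) (hbeta : 0 ≤ beta) {h : ℝ} (hh : 0 < h) (x : H0 a b) :
    ∃ p ∈ hc.genGraph hK lam beta, p.1 - h • p.2 = x := by
  obtain ⟨c, hcpos, hcge⟩ := hc.exists_potForm_ge hK hlam hbeta
  set Q : Lp ℝ 2 (muEta a b) →L[ℝ] Lp ℝ 2 (muEta a b) →L[ℝ] ℝ :=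
    (innerForm _).bilinearComp hc.primOp hc.primOp + h ^ 2 • hc.potForm hK lam beta +
      h • (innerForm ℝ).bilinearComp hc.evOp hc.evOp with hQ
  have hQa : ∀ g ψ, Q g ψ = inner ℝ (hc.primOp g) (hc.primOp ψ) +
      h ^ 2 * hc.potForm hK lam beta g ψ + h * (hc.evOp g * hc.evOp ψ) := fun g ψ => by
    simp [hQ, mul_comm (hc.evOp ψ)]
  have hQc : IsCoercive Q := by
    refine ⟨h ^ 2 * c, by positivity, fun g => ?_⟩
    rw [hQa, mul_assoc, mul_assoc, ← pow_two]
    have h1 : 0 ≤ inner ℝ (hc.primOp g) (hc.primOp g) := real_inner_self_nonneg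
    have h2 : 0 ≤ h * (hc.evOp g * hc.evOp g) := mul_nonneg hh.le (mul_self_nonneg _)
    have h3 := mul_le_mul_of_nonneg_left (hcge g) (sq_nonneg h)
    linarith
  set f := der x.fst
  set l : Lp ℝ 2 (muEta a b) →L[ℝ] ℝ :=
    innerForm _ (hc.primOp f + h • x.snd) ∘L hc.primOp + (h * hc.evOp f) • hc.evOp with hl
  obtain ⟨g, hg⟩ : ∃ g, ∀ ψ, Q g ψ = l ψ := by
    refine ⟨hQc.continuousLinearEquivOfBilin.symm ((InnerProductSpace.toDual ℝ _).symm l),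
      fun ψ => ?_⟩
    rw [← hQc.continuousLinearEquivOfBilin_apply, ContinuousLinearEquiv.apply_symm_apply,
      InnerProductSpace.toDual_symm_apply]
  set v := h⁻¹ • (g - f) with hv
  have hhv : h • v = g - f := smul_inv_smul₀ hh.ne' _
  refine ⟨(WithLp.toLp 2 (hc.ofDer g, hc.primOp v),
    WithLp.toLp 2 (hc.ofDer v, h⁻¹ • (hc.primOp v - x.snd))), ⟨rfl, fun ψ => ?_⟩, ?_⟩
  · change hc.potForm hK lam beta g ψ + inner ℝ (h⁻¹ • (hc.primOp v - x.snd)) (hc.primOp ψ) +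
      hc.evOp v * hc.evOp ψ = 0
    have h1 := hg ψ
    rw [hQa] at h1
    have h2 : l ψ = inner ℝ (hc.primOp f) (hc.primOp ψ) + h * inner ℝ x.snd (hc.primOp ψ) +
        h * hc.evOp f * hc.evOp ψ := by
      simp [hl]
    rw [h2] at h1
    have h3 : h * inner ℝ (hc.primOp v) (hc.primOp ψ) =
        inner ℝ (hc.primOp g) (hc.primOp ψ) - inner ℝ (hc.primOp f) (hc.primOp ψ) := by
      rw [← real_inner_smul_left, ← map_smul, hhv, map_sub, inner_sub_left]
    have h4 : h * hc.evOp v = hc.evOp g - hc.evOp f := by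
      rw [← smul_eq_mul, ← map_smul, hhv, map_sub]
    rw [real_inner_smul_left, inner_sub_left]
    have h5 : h ^ 2 * (hc.potForm hK lam beta g ψ + h⁻¹ * (inner ℝ (hc.primOp v) (hc.primOp ψ) -
        inner ℝ x.snd (hc.primOp ψ)) + hc.evOp v * hc.evOp ψ) = 0 := by
      have h6 : h ^ 2 * h⁻¹ = h := by field_simp
      linear_combination h1 + (inner ℝ (hc.primOp v) (hc.primOp ψ) -
        inner ℝ x.snd (hc.primOp ψ)) * h6 + h3 + h * hc.evOp ψ * h4
    exact (mul_eq_zero.1 h5).resolve_left (by positivity)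
  · refine (WithLp.ofLp_injective 2) (Prod.ext ?_ ?_)
    · change hc.ofDer g - h • hc.ofDer v = x.fst
      refine hc.H10_ext ?_
      change g - h • v = f
      rw [hhv, sub_sub_cancel]
    · change hc.primOp v - h • h⁻¹ • (hc.primOp v - x.snd) = x.snd
      rw [smul_inv_smul₀ hh.ne', sub_sub_cancel]

lemma genGraph_single (hc : CoeffHyp a b d K₁ K₂) (hK : K₁ + 2 * K₂ ≤ 2) {lam beta : ℝ}
    (F : H0 a b) (hF : ((0 : H0 a b), F) ∈ hc.genGraph hK lam beta) : F = 0 := by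
  obtain ⟨h1, h2⟩ := hF
  have h3 : F.fst = 0 := by
    apply hc.toL2_injective
    rw [hc.toL2_eq]
    exact h1.symm
  have h4 : fstDer a b F = 0 := by
    change derL a b F.fst = 0
    rw [h3, map_zero]
  simp only [h4, map_zero, zero_mul, add_zero, zero_apply, zero_add] at h2
  have h5 := ((hc.weakForm_iff 0 F.snd 0).1 fun h => by
    rw [inner_zero_left, zero_add, zero_mul]
    exact h2 h).1
  have h6 : (fun x => eta a b x * (0 : Lp ℝ 2 (muEta a b)) x)
      =ᵐ[volume.restrict (Ioo (0 : ℝ) 1)] fun _ => 0 := by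
    have := Lp.coeFn_zero ℝ 2 (muEta a b)
    rw [Filter.EventuallyEq, hc.ae_muEta] at this
    filter_upwards [this] with x hx
    rw [hx, Pi.zero_apply, mul_zero]
  have h7 := (h5.congr_left h6 IsWeakDeriv.zero.1).unique IsWeakDeriv.zero
  have h8 : F.snd = 0 := by
    refine Lp.ext ?_
    have := Lp.coeFn_zero ℝ 2 (muSig a b)
    rw [Filter.EventuallyEq, hc.ae_muSig] at this ⊢
    filter_upwards [this, h7, ae_mem_Ioo] with x hx h7 hxm
    rw [hx, Pi.zero_apply]
    exact (div_eq_zero_iff.1 h7).resolve_right (hc.sig_pos hxm).ne'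
  exact (WithLp.ofLp_injective 2) (Prod.ext h3 h8)

/-- The generator is maximal dissipative: `E(𝓐 U, U) = - v(1)²` for `U = (u, v)`. -/
theorem isMaxDissipative (hc : CoeffHyp a b d K₁ K₂) (hK : K₁ + 2 * K₂ ≤ 2) {lam beta : ℝ}
    (hlam : lam < 1 / CHP a b d) (hbeta : 0 ≤ beta) :
    IsMaxDissipative (hc.energy hK lam beta) (hc.genGraph hK lam beta) where
  symm U V := by
    rw [hc.energy_apply, hc.energy_apply, hc.potForm_apply, hc.potForm_apply, hc.inner_potOp,
      hc.inner_potOp, real_inner_comm, real_inner_comm V.snd]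
    simp only [mul_comm (hc.primOp (der V.fst) _), mul_comm (hc.evOp (der V.fst))]
  coercive := hc.energy_coercive hK hlam hbeta
  dissipative := by
    rintro ⟨U, F⟩ ⟨h1, h2⟩
    have hsymm : hc.potForm hK lam beta (der F.fst) (der U.fst) =
        hc.potForm hK lam beta (der U.fst) (der F.fst) := by
      rw [hc.potForm_apply, hc.potForm_apply, hc.inner_potOp, hc.inner_potOp, real_inner_comm]
      simp only [mul_comm (hc.primOp (der F.fst) _), mul_comm (hc.evOp (der F.fst))]
    change U.snd = hc.primOp (der F.fst) at h1
    have h3 : hc.potForm hK lam beta (der U.fst) (der F.fst) +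
      inner ℝ F.snd (hc.primOp (der F.fst)) + hc.evOp (der F.fst) * hc.evOp (der F.fst) = 0 :=
      h2 (der F.fst)
    change hc.energy hK lam beta F U ≤ 0
    rw [hc.energy_apply, h1, hsymm]
    linarith [mul_self_nonneg (hc.evOp (der F.fst))]
  range h hh x := hc.genGraph_range hK hlam hbeta hh x
  single F hF := hc.genGraph_single hK F hF

end CoeffHyp

variable {lam beta : ℝ}

/-! ### Mild and classical solutions of the wave equation -/

lemma contDiffOn_one_Ici {E : Type*} [NormedAddCommGroup E] [NormedSpace ℝ E] {f g : ℝ → E}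
    (h : ∀ t, 0 ≤ t → HasDerivWithinAt f (g t) (Ici 0) t) (hg : ContinuousOn g (Ici 0)) :
    ContDiffOn ℝ 1 f (Ici 0) := by
  rw [contDiffOn_one_iff_derivWithin (uniqueDiffOn_Ici 0)]
  exact ⟨fun t ht => (h t ht).differentiableWithinAt,
    hg.congr fun t ht => (h t ht).derivWithin (uniqueDiffOn_Ici 0 t ht)⟩

lemma contDiffOn_two_Ici {E : Type*} [NormedAddCommGroup E] [NormedSpace ℝ E] {f g h : ℝ → E}
    (hf : ∀ t, 0 ≤ t → HasDerivWithinAt f (g t) (Ici 0) t)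
    (hg : ∀ t, 0 ≤ t → HasDerivWithinAt g (h t) (Ici 0) t) (hh : ContinuousOn h (Ici 0)) :
    ContDiffOn ℝ 2 f (Ici 0) ∧ ∀ t, 0 ≤ t → iteratedDerivWithin 2 f (Ici 0) t = h t := by
  have hdw : EqOn (derivWithin f (Ici 0)) g (Ici 0) := fun t ht =>
    (hf t ht).derivWithin (uniqueDiffOn_Ici 0 t ht)
  refine ⟨?_, fun t ht => ?_⟩
  · rw [show (2 : WithTop ℕ∞) = 1 + 1 by norm_num,
      contDiffOn_succ_iff_derivWithin (uniqueDiffOn_Ici 0)]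
    refine ⟨fun t ht => (hf t ht).differentiableWithinAt, fun h => ?_, ?_⟩
    · exact absurd h (by simp)
    · exact (contDiffOn_one_Ici hg hh).congr hdw
  · rw [iteratedDerivWithin_succ, iteratedDerivWithin_one, derivWithin_congr hdw (hdw ht),
      (hg t ht).derivWithin (uniqueDiffOn_Ici 0 t ht)]

lemma continuousOn_DAlam {s : Set ℝ} {w : ℝ → DAlam a b d lam}
    (h1 : ContinuousOn (fun t => domToH10 (w t)) s)
    (h2 : ContinuousOn (fun t => opA (w t).1.fst) s)
    (h3 : ContinuousOn (fun t => opAlam (w t)) s) : ContinuousOn w s := by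
  rw [Topology.IsInducing.subtypeVal.continuousOn_iff]
  refine (WithLp.prod_continuous_toLp 2 _ _).comp_continuousOn
    (ContinuousOn.prodMk (f := fun t => (w t).1.fst) (g := fun t => (w t).1.snd) ?_ h3)
  rw [Topology.IsInducing.subtypeVal.continuousOn_iff]
  exact (WithLp.prod_continuous_toLp 2 _ _).comp_continuousOn
    (ContinuousOn.prodMk (f := fun t => ((w t).1.fst).1.fst) (g := fun t => ((w t).1.fst).1.snd)
      h1 h2)

namespace CoeffHyp

lemma isMildCauchy_iff (hc : CoeffHyp a b d K₁ K₂) (hK : K₁ + 2 * K₂ ≤ 2) (Y₀ : H0 a b)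
    (Y : ℝ → H0 a b) :
    IsMildCauchy a b d lam beta Y₀ Y ↔ IsMild (hc.genGraph hK lam beta) Y₀ Y :=
  and_congr Iff.rfl (forall_congr' fun _ => forall_congr' fun _ =>
    (hc.mem_genGraph hK _ _).symm)

/-- In a mild solution `(y, z)`, the component `z` is the velocity of `y` in `L²_{1/σ}`. -/
lemma hasDerivWithinAt_curveL2 (hc : CoeffHyp a b d K₁ K₂) (hK : K₁ + 2 * K₂ ≤ 2)
    {Y₀ : H0 a b} {Y : ℝ → H0 a b} (hY : IsMild (hc.genGraph hK lam beta) Y₀ Y) {t : ℝ}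
    (ht : 0 ≤ t) :
    HasDerivWithinAt (curveL2 fun t => (Y t).fst) (Y t).snd (Ici 0) t := by
  have : CompleteSpace (H10 a b) := hc.completeSpace_H10
  set P := WithLp.sndL 2 ℝ (H10 a b) (L2w a b)
  have hP : ContinuousOn (fun t => P (Y t)) (Ici 0) := P.continuous.comp_continuousOn hY.1
  have hcurve : ∀ t, 0 ≤ t →
      curveL2 (fun t => (Y t).fst) t = toL2 Y₀.fst + ∫ s in (0 : ℝ)..t, P (Y s) := by
    intro t ht
    have h1 := (hY.2 t ht).1
    change P (∫ s in (0 : ℝ)..t, Y s) = hc.primOp (der (Y t - Y₀).fst) at h1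
    rw [← hc.toL2_eq, ← ContinuousLinearMap.intervalIntegral_comp_comm P
      (intervalIntegrable_of_continuousOn_Ici hY.1 ht)] at h1
    have h2 : toL2 (Y t - Y₀).fst = toL2 (Y t).fst - toL2 Y₀.fst :=
      map_sub (toL2L a b) (Y t).fst Y₀.fst
    rw [h1, h2, add_sub_cancel]
    rfl
  exact ((hasDerivWithinAt_integral_Ici hP ht).const_add _).congr hcurve (hcurve t ht)

/-- A `C¹` solution `Y = (y, z)` of `Y' = 𝓐 Y` in the energy space yields a classical solution `y`;
the graph norm of `y` is continuous because `A y = y_tt - λ y / d` is. -/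
lemma isClassicalSolution (hc : CoeffHyp a b d K₁ K₂) (hK : K₁ + 2 * K₂ ≤ 2)
    {Y Z : ℝ → H0 a b} (hZ : ContinuousOn Z (Ici 0))
    (hYZ : ∀ t, 0 ≤ t → (Y t, Z t) ∈ hc.genGraph hK lam beta ∧
      HasDerivWithinAt Y (Z t) (Ici 0) t) :
    IsClassicalSolution a b d lam beta fun t => (Y t).fst := by
  have hgen : ∀ t, 0 ≤ t → Gen a b d lam beta (Y t) (Z t) := fun t ht =>
    (hc.mem_genGraph hK _ _).1 (hYZ t ht).1
  set P₁ := WithLp.fstL 2 ℝ (H10 a b) (L2w a b)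
  set P₂ := WithLp.sndL 2 ℝ (H10 a b) (L2w a b)
  have hfst : ∀ t, 0 ≤ t → HasDerivWithinAt (fun t => (Y t).fst) (Z t).fst (Ici 0) t :=
    fun t ht => P₁.hasFDerivAt.comp_hasDerivWithinAt t (hYZ t ht).2
  have hsnd : ∀ t, 0 ≤ t → HasDerivWithinAt (fun t => (Y t).snd) (Z t).snd (Ici 0) t :=
    fun t ht => P₂.hasFDerivAt.comp_hasDerivWithinAt t (hYZ t ht).2
  have hZ₁ : ContinuousOn (fun t => (Z t).fst) (Ici 0) := P₁.continuous.comp_continuousOn hZ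
  have hZ₂ : ContinuousOn (fun t => (Z t).snd) (Ici 0) := P₂.continuous.comp_continuousOn hZ
  have hcurve : ∀ t, 0 ≤ t →
      HasDerivWithinAt (curveL2 fun t => (Y t).fst) (Y t).snd (Ici 0) t := fun t ht => by
    rw [← (hgen t ht).2.1]
    exact (toL2L a b).hasFDerivAt.comp_hasDerivWithinAt t (hfst t ht)
  have h2 := contDiffOn_two_Ici hcurve hsnd hZ₂
  refine ⟨h2.1, contDiffOn_one_Ici hfst hZ₁, ?_, fun t ht => ?_⟩
  · have hex : ∀ t, ∃ w : DAlam a b d lam, 0 ≤ t →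
        domToH10 w = (Y t).fst ∧ opAlam w = (Z t).snd := fun t => by
      by_cases ht : 0 ≤ t
      · obtain ⟨w, hw⟩ := (hgen t ht).1
        exact ⟨w, fun _ => hw⟩
      · exact ⟨0, fun h => absurd h ht⟩
    choose w hw using hex
    have hYc : ContinuousOn (fun t => (Y t).fst) (Ici 0) := fun t ht =>
      (hfst t ht).continuousWithinAt
    refine ⟨w, continuousOn_DAlam ?_ ?_ ?_, fun t ht => ⟨(hw t ht).1, ?_⟩⟩
    · exact hYc.congr fun t ht => (hw t ht).1
    · have h1 : ContinuousOn
          (fun t => (Z t).snd - lam • hc.potOp hK (derL a b (Y t).fst)) (Ici 0) :=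
        hZ₂.sub (((hc.potOp hK ∘L derL a b).continuous.comp_continuousOn hYc).const_smul lam)
      refine h1.congr fun t ht => ?_
      rw [hc.opA_eq hK, (hw t ht).1, (hw t ht).2]
      rfl
    · exact hZ₂.congr fun t ht => (hw t ht).2
    · rw [h2.2 t ht, (hw t ht).2]
  · rw [(hfst t ht).derivWithin (uniqueDiffOn_Ici 0 t ht)]
    exact (hgen t ht).2.2

end CoeffHyp

end DegWave

end

theorem theorem2p6 (a b d : ℝ → ℝ) (K₁ K₂ lam beta : ℝ)
    (hcoeff : DegWave.CoeffHyp a b d K₁ K₂)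
    (hlam0 : lam ≠ 0) (hlam : lam < 1 / DegWave.CHP a b d)
    (hbeta : 0 ≤ beta) (hK : K₁ + 2 * K₂ ≤ 2) :
    -- existence and uniqueness of the mild solution, and its regularity
    (∀ (y₀ : DegWave.H10 a b) (y₁ : DegWave.L2w a b), ∃ y : ℝ → DegWave.H10 a b,
      DegWave.IsMildSolution a b d lam beta y₀ y₁ y ∧
      ContDiffOn ℝ 1 (DegWave.curveL2 y) (Set.Ici 0) ∧
      ContinuousOn y (Set.Ici 0) ∧
      y 0 = y₀ ∧ DegWave.velL2 y 0 = y₁ ∧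
      ∀ z : ℝ → DegWave.H10 a b, DegWave.IsMildSolution a b d lam beta y₀ y₁ z →
        Set.EqOn z y (Set.Ici 0)) ∧
    -- continuous dependence on the initial data
    (∃ C : ℝ, 0 < C ∧ ∀ (y₀ z₀ : DegWave.H10 a b) (y₁ z₁ : DegWave.L2w a b)
      (y z : ℝ → DegWave.H10 a b),
      DegWave.IsMildSolution a b d lam beta y₀ y₁ y →
      DegWave.IsMildSolution a b d lam beta z₀ z₁ z →
      ∀ t : ℝ, 0 ≤ t →
        ‖y t - z t‖ + ‖DegWave.velL2 y t - DegWave.velL2 z t‖ ≤ C * (‖y₀ - z₀‖ + ‖y₁ - z₁‖)) ∧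
    -- classical solutions for regular data that satisfy the boundary condition
    (∀ (y₀ : DegWave.H2 a b) (y₁ : DegWave.H10 a b),
      DegWave.BoundaryCond beta (DegWave.toH10 y₀) y₁ →
      ∀ y : ℝ → DegWave.H10 a b,
        DegWave.IsMildSolution a b d lam beta (DegWave.toH10 y₀) (DegWave.toL2 y₁) y →
        DegWave.IsClassicalSolution a b d lam beta y) := by
  have hcomplete : CompleteSpace (DegWave.H10 a b) := hcoeff.completeSpace_H10
  have hG := hcoeff.isMaxDissipative hK hlam hbeta
  have hvel : ∀ {Y₀ : DegWave.H0 a b} {Y : ℝ → DegWave.H0 a b},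
      DegWave.IsMild (hcoeff.genGraph hK lam beta) Y₀ Y → ∀ t, 0 ≤ t →
      DegWave.velL2 (fun t => (Y t).fst) t = (Y t).snd := fun hY t ht =>
    (hcoeff.hasDerivWithinAt_curveL2 hK hY ht).derivWithin (uniqueDiffOn_Ici 0 t ht)
  refine ⟨fun y₀ y₁ => ?_, ?_, fun y₀ y₁ hbc y => ?_⟩
  · obtain ⟨Y, hY, -⟩ := hG.exists_mild (WithLp.toLp 2 (y₀, y₁))
    refine ⟨fun t => (Y t).fst, ⟨fun t => (Y t).snd, (hcoeff.isMildCauchy_iff hK _ _).2 hY⟩,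
      ?_, ?_, ?_, ?_, ?_⟩
    · exact DegWave.contDiffOn_one_Ici
        (fun t ht => hcoeff.hasDerivWithinAt_curveL2 hK hY ht)
        ((WithLp.sndL 2 ℝ _ _).continuous.comp_continuousOn hY.1)
    · exact (WithLp.fstL 2 ℝ _ _).continuous.comp_continuousOn hY.1
    · exact congrArg WithLp.fst (hG.mild_zero hY)
    · exact (hvel hY 0 le_rfl).trans (congrArg WithLp.snd (hG.mild_zero hY))
    · rintro z ⟨z', hz⟩ t ht
      have := hG.mild_unique ((hcoeff.isMildCauchy_iff hK _ _).1 hz) hY ht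
      exact congrArg WithLp.fst this
  · obtain ⟨L, hL, hLn⟩ := hG.exists_norm_le
    refine ⟨2 * L, by positivity, ?_⟩
    rintro y₀ z₀ y₁ z₁ y z ⟨y', hy⟩ ⟨z', hz⟩ t ht
    have hy := (hcoeff.isMildCauchy_iff hK _ _).1 hy
    have hz := (hcoeff.isMildCauchy_iff hK _ _).1 hz
    have h1 := hLn _ _ (hG.mild_form_le (hy.sub hz) ht)
    have h2 := WithLp.norm_fst_le _ (WithLp.toLp 2 (y t, y' t) - WithLp.toLp 2 (z t, z' t))
    have h3 := WithLp.norm_snd_le _ (WithLp.toLp 2 (y t, y' t) - WithLp.toLp 2 (z t, z' t))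
    have h4 : ‖(WithLp.toLp 2 (y₀, y₁) - WithLp.toLp 2 (z₀, z₁) : DegWave.H0 a b)‖ ≤
        ‖y₀ - z₀‖ + ‖y₁ - z₁‖ := by
      apply abs_le_of_sq_le_sq' _ (by positivity) |>.2
      rw [WithLp.prod_norm_sq_eq_of_L2]
      change ‖y₀ - z₀‖ ^ 2 + ‖y₁ - z₁‖ ^ 2 ≤ _
      nlinarith [mul_nonneg (norm_nonneg (y₀ - z₀)) (norm_nonneg (y₁ - z₁))]
    have h5 : DegWave.velL2 y t = y' t := hvel hy t ht
    have h6 : DegWave.velL2 z t = z' t := hvel hz t ht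
    rw [h5, h6]
    change ‖y t - z t‖ ≤ _ at h2
    change ‖y' t - z' t‖ ≤ _ at h3
    have h7 := mul_le_mul_of_nonneg_left h4 hL.le
    linarith
  · rintro ⟨y', hy⟩
    have hy := (hcoeff.isMildCauchy_iff hK _ _).1 hy
    -- as `u / d ∈ L²_{1/σ}`, the domains of `A_λ` and of `A` coincide
    have hp : ((WithLp.toLp 2 (DegWave.toH10 y₀, DegWave.toL2 y₁), WithLp.toLp 2 (y₁,
        DegWave.opA y₀ + lam • hcoeff.potOp hK (DegWave.der (DegWave.toH10 y₀)))) :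
        DegWave.H0 a b × DegWave.H0 a b) ∈ hcoeff.genGraph hK lam beta := by
      rw [hcoeff.mem_genGraph hK]
      exact ⟨⟨⟨WithLp.toLp 2 (y₀, _), (hcoeff.mem_DAlam_iff hK _ _).2 rfl⟩, rfl, rfl⟩, rfl, hbc⟩
    obtain ⟨Z, hZ, hYZ⟩ := hG.mild_of_mem_domain hp hy
    exact hcoeff.isClassicalSolution hK hZ hYZ
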